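/- **Setting.** Fix $n\ge 1$, $m\ge 0$ and pairwise distinct complex numbers $p_1,\dots,p_{n+1},q_1,\dots,q_m$. In the blow-up of $0\in\mathbb C^2$ use the chart $(x,u)$, $u=y/x$, and let $\mathcal L$ (given by $x=0$) be the exceptional divisor; $\tilde{\mathcal F}$ denotes the blow-up of a foliation $\mathcal F$. Foliations are given by germs of holomorphic vector fields with an isolated singularity at $0$. * $\mathcal N_{\mathsf p}(\mathbf h)$: non dicritical foliations given by a field $v=(P,Q)$ of order $n$ with $xQ_n-yP_n=c\prod_i(y-p_ix)$, $c\ne0$, whose hidden holonomy (the holonomy of the leaf $\mathcal L\smallsetminus\{p_i\}$ of the blow-up) is conjugate to $\mathbf h$ by one germ tangent to the identity. * $\mathcal D_{\mathsf q}(\mathcal I)$, $\mathcal I=(I_1,\dots,I_m)$: dicritical foliations given by a field of order $m+1$ with principal part $c\prod_j(y-q_jx)\cdot(x,y)$, $c\neq0$, whose blow-up is regular at the (simple) tangency points $(0,q_j)$; $I_j$ is the holomorphic involution at $q_j$ ($I_j(q_j)=q_j$, $I_j'(q_j)=-1$) exchanging the two intersection points of a leaf with $\mathcal L$. Put $g_j(u)=(q_j-u)(I_j(u)-q_j)$.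 Let $(\mathcal F,\mathcal G)\in\mathcal N_{\mathsf p}(\mathbf h)\times\mathcal D_{\mathsf q}(\mathcal I)$, let $\mathcal F_\mu\in\mathcal N_{\mathsf p}(\mathbf h)$ have exactly the lines $y=p_ix$ as separatrices, let $\lambda_i$ be the Camacho–Sad index of $\tilde{\mathcal F}_\mu$ at $(0,p_i)$ relative to $\mathcal L$, and let $\mathcal G_{\mathbf r}$ be the radial foliation. *Local models and normalizing transformations* of $(\mathcal F,\mathcal G)$ with respect to $(\mathcal F_\mu,\mathcal G_{\mathbf r})$ consist of the following. * Germs of holomorphic functions $s_i(x)=\sum_{r\ge1}s_{i,r}x^r$, $z_j(x)=\sum_{r\ge1}z_{j,r}x^r$ with $z_{j,1}\ne0$. * A biholomorphism $\mathbf H_{\mathbf n}$ between neighbourhoods of $\mathcal L\smallsetminus\{p_i,q_j\}$ (including $u=\infty$) in the blow-up, $\mathbf H_{\mathbf n}(x,u)=(x+O(x^2),u+O(x))$, taking $(\tilde{\mathcal F}_\mu,\tilde{\mathcal G}_{\mathbf r})$ to $(\tilde{\mathcal F},\tilde{\mathcal G})$; germs of biholomorphisms $H_{p_i}$ at $(0,p_i)$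 and $H_{q_j}$ at $(0,q_j)$, equal to the identity on $x=0$, such that $H_{p_i}$ takes the foliations of $\lambda_ix\partial_x+(u-p_i)\partial_u$ and $u+s_i(x)=\mathrm{cst}$ to $(\tilde{\mathcal F},\tilde{\mathcal G})$, and $H_{q_j}$ takes $x=\mathrm{cst}$ and $z_j(x)+g_j(u)=\mathrm{cst}$ to $(\tilde{\mathcal F},\tilde{\mathcal G})$. * The factorizations $H_{p_i}=\mathbf H_{\mathbf n}\circ\xi_i\circ\Psi_i$, $H_{q_j}=\mathbf H_{\mathbf n}\circ\zeta_j\circ\Phi_j$ hold near punctured discs around $p_i$, $q_j$ in $\mathcal L$. Here $\Psi_i=\bigl(x(1+\tfrac{s_i(x)}{u-p_i})^{\lambda_i},u+s_i(x)\bigr)$; $\Phi_j=(x,\phi_j)$ with $g_j(\phi_j(x,u))=g_j(u)+z_j(x)$, $\phi_j(0,u)=u$; $\xi_i=(\varepsilon_i,u)$, $\varepsilon_i=\sum_{k\ge1}\varepsilon_{i,k}(u)x^k$, holomorphic at $(0,p_i)$, takes the foliation of $\lambda_ix\partial_x+(u-p_i)\partial_u$ to $\tilde{\mathcal F}_\mu$,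 with $\varepsilon_{i,1}(p_i)=1$; $\zeta_j=(\varsigma_j,u)$, $\varsigma_j=\sum_{k\ge1}\varsigma_{j,k}(u)x^k$, holomorphic at $(0,q_j)$, takes $x=\mathrm{cst}$ to $\tilde{\mathcal F}_\mu$, with $\varsigma_{j,1}(q_j)=1$ and $\varsigma_{j,k}(q_j)=0$ for $k\ge2$. **Normal form.** Write $[x^k]$ for the coefficient of $x^k$, and $(\cdot)_{\mathcal P,a}$ for the principal part at $a$. Define $a_{\mathbf n,1}=1$, $a_{p_i,1}=\varepsilon_{i,1}$, $a_{q_j,1}=\varsigma_{j,1}$, $b_{\mathbf n,1}=-\sum_j\bigl(\tfrac{z_{j,1}}{\varsigma_{j,1}g_j'}\bigr)_{\mathcal P,q_j}$, $b_{p_i,1}=s_{i,1}+\varepsilon_{i,1}b_{\mathbf n,1}$, $b_{q_j,1}=\tfrac{z_{j,1}}{g_j'}+\varsigma_{j,1}b_{\mathbf n,1}$. For $k\ge2$, with $A=\sum_{r<k}a_{\mathbf n,r}(u)x^r$ and $B=u+\sum_{r<k}b_{\mathbf n,r}(u)x^r$, put $$\mathbf A_{p_i}=[x^k](A\circ\xi_i\circ\Psi_i)-\varepsilon_{i,k},\qquad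 \mathbf A_{q_j}=[x^k](A\circ\zeta_j\circ\Phi_j)-\varsigma_{j,k},$$ $$\mathbf B_{p_i}=[x^k](B\circ\xi_i\circ\Psi_i)-s_{i,k}-\varepsilon_{i,k}b_{\mathbf n,1},\qquad \mathbf B_{q_j}=[x^k](B\circ\zeta_j\circ\Phi_j)-\tfrac{z_{j,k}}{g_j'}-\varsigma_{j,k}b_{\mathbf n,1},$$ $$a_{\mathbf n,k}=-\sum_i\Bigl(\tfrac{\mathbf A_{p_i}}{\varepsilon_{i,1}^k}\Bigr)_{\mathcal P,p_i}-\sum_j\Bigl(\tfrac{\mathbf A_{q_j}}{\varsigma_{j,1}^k}\Bigr)_{\mathcal P,q_j},\qquad b_{\mathbf n,k}=-\sum_i\Bigl(\tfrac{\mathbf B_{p_i}}{\varepsilon_{i,1}^k}\Bigr)_{\mathcal P,p_i}-\sum_j\Bigl(\tfrac{z_{j,k}}{\varsigma_{j,1}^kg_j'}+\tfrac{\mathbf B_{q_j}}{\varsigma_{j,1}^k}\Bigr)_{\mathcal P,q_j},$$ $$a_{p_i,k}=\varepsilon_{i,k}+\mathbf A_{p_i}+\varepsilon_{i,1}^ka_{\mathbf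 n,k},\qquad a_{q_j,k}=\varsigma_{j,k}+\mathbf A_{q_j}+\varsigma_{j,1}^ka_{\mathbf n,k},$$ $$b_{p_i,k}=s_{i,k}+\varepsilon_{i,k}b_{\mathbf n,1}+\mathbf B_{p_i}+\varepsilon_{i,1}^kb_{\mathbf n,k},\qquad b_{q_j,k}=\tfrac{z_{j,k}}{g_j'}+\varsigma_{j,k}b_{\mathbf n,1}+\mathbf B_{q_j}+\varsigma_{j,1}^kb_{\mathbf n,k}.$$ The normalizing transformations are in *$k_0$-normal form* if, for each of $\cdot=\mathbf n,p_i,q_j$, the corresponding transformation is $\bigl(\sum_{k\le k_0}a_{\cdot,k}x^k+O(x^{k_0+1}),\,u+\sum_{k\le k_0}b_{\cdot,k}x^k+O(x^{k_0+1})\bigr)$. **Theorem.** There are functional transformations $\boldsymbol\pi_{p_i,k}$, $\boldsymbol\pi_{q_j,k}$ ($k\ge1$), depending only on $\mathsf p$, $\mathsf q$, with $\boldsymbol\pi_{p_i,1}=0$ and $\boldsymbol\pi_{q_j,1}=0$, such that the following holds whenever the local models and normalizing transformations of $(\mathcal F,\mathcal G)$ as above are in $k_0$-normal form. Near $(0,p_i)$,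 respectively $(0,q_j)$, the curve of tangencies of $(\tilde{\mathcal F},\tilde{\mathcal G})$ is the graph $u=\pi_{p_i}(x)$, respectively $u=\pi_{q_j}(x)$, of a holomorphic germ $\pi_{p_i}=p_i+\sum_{r\ge1}\mathbf c_{p_i,r}x^r$, respectively $\pi_{q_j}=q_j+\sum_{r\ge1}\mathbf c_{q_j,r}x^r$, and for $1\le k\le k_0$ $$\mathbf c_{p_i,k}=(1-k\lambda_i)s_{i,k}-\sum_{j=1}^m\frac{z_{j,k}}{2(p_i-q_j)}+\boldsymbol\pi_{p_i,k}(p_i),$$ $$\mathbf c_{q_j,k}=-\frac{z_{j,k}}2\Bigl(k\,\varsigma_{j,1}'(q_j)+\frac{g_j'''(q_j)}4\Bigr)-\sum_{l\ne j}\frac{z_{l,k}}{2(q_j-q_l)}+\boldsymbol\pi_{q_j,k}(q_j).$$ Here $\boldsymbol\pi_{p_i,k}$, respectively $\boldsymbol\pi_{q_j,k}$, is a function holomorphic at $p_i$, respectively $q_j$, obtained by evaluating the functional transformation at the germ $\varepsilon_{i,k}$ at $p_i$, respectively $\varsigma_{j,k}$ at $q_j$, and at the data of order at most $k-1$: the numbers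 $\lambda_\imath,s_{\imath,r},z_{\jmath,r}$ and the germs $g_\jmath$ and $\varsigma_{\jmath,r}$ at $q_\jmath$ and $\varepsilon_{\imath,r}$ at $p_\imath$, for all $\imath,\jmath$ and $1\le r\le k-1$. -/

import Mathlib

open Filter Topology Set
open scoped Nat

noncomputable section

namespace TangencyCurves

/-! ### Taylor coefficients, homogeneous parts, principal parts -/

/-- The coefficient of `(t - c)^k` in the Taylor expansion of `f` at `c`. -/
def taylorCoeff (k : ℕ) (f : ℂ → ℂ) (c : ℂ) : ℂ :=
  iteratedDeriv k f c / (k ! : ℂ)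

/-- The coefficient `F_k(u)` of `x^k` in the expansion `F (x, u) = ∑ F_k(u) x^k` along `x = 0`. -/
def coeffX (k : ℕ) (F : ℂ × ℂ → ℂ) (u : ℂ) : ℂ :=
  taylorCoeff k (fun x => F (x, u)) 0

/-- The value at `a` of the homogeneous part of degree `d` of the Taylor expansion of `f` at the
origin: the coefficient of `t^d` in `t ↦ f (t a)`. -/
def homPart (d : ℕ) (f : ℂ × ℂ → ℂ) (a : ℂ × ℂ) : ℂ :=
  taylorCoeff d (fun t => f (t • a)) 0

/-- `P` (a polynomial in `(u - a)⁻¹` without constant term) is the principal part at `a` of the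
function `f`, meromorphic at `a`: the difference extends holomorphically to `a`. -/
def IsPrincipalPart (f : ℂ → ℂ) (a : ℂ) (P : Polynomial ℂ) : Prop :=
  P.coeff 0 = 0 ∧ ∃ r : ℂ → ℂ, AnalyticAt ℂ r a ∧
    ∀ᶠ u in 𝓝[≠] a, f u = P.eval (u - a)⁻¹ + r u

open Classical in
/-- The principal part of `f` at `a`, as a function on `ℂ` (holomorphic off `a`). -/
def principalPart (f : ℂ → ℂ) (a : ℂ) : ℂ → ℂ :=
  if h : ∃ P, IsPrincipalPart f a P then fun u => h.choose.eval (u - a)⁻¹ else 0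

/-! ### Vector fields, blow-up, foliations -/

/-- The lift to the chart `(x, u)`, `u = y / x`, of a vector field `v = (P, Q)` at the origin,
multiplied by `x^(-e)`. Off the divisor `x = 0` this is
`x^(-e) (P (x, xu), (Q (x, xu) - u P (x, xu)) / x)`; on the divisor it is the coefficient of `x^0`
of these expressions (`e = ν - 1` for a non dicritical and `e = ν` for a dicritical field of
order `ν` gives the blow-up). -/
def blowUp (e : ℕ) (v : ℂ × ℂ → ℂ × ℂ) (z : ℂ × ℂ) : ℂ × ℂ :=
  open Classical in
  if z.1 = 0 then
    (homPart e (fun a => (v a).1) (1, z.2),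
      homPart (e + 1) (fun a => (v a).2) (1, z.2)
        - z.2 * homPart (e + 1) (fun a => (v a).1) (1, z.2))
  else
    ((v (z.1, z.1 * z.2)).1 / z.1 ^ e,
      ((v (z.1, z.1 * z.2)).2 - z.2 * (v (z.1, z.1 * z.2)).1) / z.1 ^ (e + 1))

/-- The radial vector field `x ∂/∂x + y ∂/∂y`. -/
def radial : ℂ × ℂ → ℂ × ℂ := fun z => z

/-- The points where the foliations defined by the fields `V` and `W` are tangent
(or one of the fields is singular). -/
def tangencyLocus (V W : ℂ × ℂ → ℂ × ℂ) : Set (ℂ × ℂ) :=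
  {z | (V z).1 * (W z).2 - (V z).2 * (W z).1 = 0}

/-- Near the set `K`, the map `H` takes the foliation defined by the field `X` to the one defined
by the field `Y`: `DH · X = f · (Y ∘ H)` with a non-vanishing holomorphic factor `f`. -/
def MapsFoliation (H X Y : ℂ × ℂ → ℂ × ℂ) (K : Set (ℂ × ℂ)) : Prop :=
  ∃ f : ℂ × ℂ → ℂ, AnalyticOnNhd ℂ f K ∧ (∀ z ∈ K, f z ≠ 0) ∧
    ∀ᶠ z in 𝓝ˢ K, fderiv ℂ H z (X z) = f z • Y (H z)

/-- `H` is a germ of biholomorphism at `z`. -/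
def IsLocalBiholomorphism (H : ℂ × ℂ → ℂ × ℂ) (z : ℂ × ℂ) : Prop :=
  AnalyticAt ℂ H z ∧ (fderiv ℂ H z).IsInvertible

/-- `v` defines a germ of holomorphic foliation at the origin, singular at most there, and all
homogeneous parts of `v` of degree `< d` vanish. -/
structure IsFoliationGerm (d : ℕ) (v : ℂ × ℂ → ℂ × ℂ) : Prop where
  analytic : AnalyticAt ℂ v 0
  singular : v 0 = 0
  isolated : ∀ᶠ z in 𝓝[≠] (0 : ℂ × ℂ), v z ≠ 0
  order_le : ∀ k < d, ∀ a,
    homPart k (fun z => (v z).1) a = 0 ∧ homPart k (fun z => (v z).2) a = 0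

/-! ### The class of non dicritical foliations with given hidden holonomy -/

/-- A (parametrized) loop in `ℂ ∖ {p_i}` based at `u₀`. -/
def IsLoopAt {ι : Type} (p : ι → ℂ) (u₀ : ℂ) (γ : ℝ → ℂ) : Prop :=
  ContDiff ℝ 1 γ ∧ γ 0 = u₀ ∧ γ 1 = u₀ ∧ ∀ t ∈ Icc (0 : ℝ) 1, ∀ i, γ t ≠ p i

/-- `f` is (as a germ at `0`) the holonomy of the foliation defined by `V` along the path `γ` in
the leaf `x = 0`, on the transversals `u = cst`: points `x₀` near `0` are transported along the
leaves over `γ`. -/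
def IsHolonomy (V : ℂ × ℂ → ℂ × ℂ) (γ : ℝ → ℂ) (f : ℂ → ℂ) : Prop :=
  ∀ δ > 0, ∀ᶠ x₀ in 𝓝 (0 : ℂ), ∃ x : ℝ → ℂ, x 0 = x₀ ∧ x 1 = f x₀ ∧
    ∀ t ∈ Icc (0 : ℝ) 1, ‖x t‖ < δ ∧
      HasDerivWithinAt x (deriv γ t * (V (x t, γ t)).1 / (V (x t, γ t)).2) (Icc 0 1) t

/-- `v` defines a foliation of the class `N_p(h)`: it is non dicritical of order `n`, the singular
points of its blow-up on the exceptional divisor are the `n + 1` simple points `(0, p_i)`, and its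
hidden (projective) holonomy is strictly analytically equivalent to `h`, i.e. conjugate to `h` by
one germ tangent to the identity. -/
structure MemN {n : ℕ} (p : Fin (n + 1) → ℂ) (u₀ : ℂ) (h : (ℝ → ℂ) → ℂ → ℂ)
    (v : ℂ × ℂ → ℂ × ℂ) : Prop where
  germ : IsFoliationGerm n v
  nondicritical : ∃ c : ℂ, c ≠ 0 ∧ ∀ a : ℂ × ℂ,
    a.1 * homPart n (fun z => (v z).2) a - a.2 * homPart n (fun z => (v z).1) a
      = c * ∏ i, (a.2 - p i * a.1)
  base : ∀ i, u₀ ≠ p i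
  holonomy : ∃ τ : ℂ → ℂ, AnalyticAt ℂ τ 0 ∧ τ 0 = 0 ∧ deriv τ 0 = 1 ∧
    ∀ γ, IsLoopAt p u₀ γ → ∃ f : ℂ → ℂ, IsHolonomy (blowUp (n - 1) v) γ f ∧
      ∀ᶠ x in 𝓝 (0 : ℂ), f (τ x) = τ (h γ x)

/-- The separatrices of the foliation defined by `v` are exactly the lines `y = p_i x`. -/
def HasStraightSeparatrices {ι : Type} (p : ι → ℂ) (v : ℂ × ℂ → ℂ × ℂ) : Prop :=
  (∀ i, ∀ᶠ x in 𝓝 (0 : ℂ), (v (x, p i * x)).2 = p i * (v (x, p i * x)).1) ∧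
  ∀ γ : ℂ → ℂ × ℂ, AnalyticAt ℂ γ 0 → γ 0 = 0 → ¬ (∀ᶠ t in 𝓝 (0 : ℂ), γ t = 0) →
    (∀ᶠ t in 𝓝 (0 : ℂ), (v (γ t)).1 * (deriv γ t).2 - (v (γ t)).2 * (deriv γ t).1 = 0) →
    ∃ i, ∀ᶠ t in 𝓝 (0 : ℂ), (γ t).2 = p i * (γ t).1

/-- The Camacho-Sad index at `(0, c)`, relative to `x = 0`, of the foliation defined by a field
`V` tangent to `x = 0` whose second component has a simple zero at `c` on `x = 0`. -/
def camachoSad (V : ℂ × ℂ → ℂ × ℂ) (c : ℂ) : ℂ :=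
  deriv (fun x => (V (x, c)).1) 0 / deriv (fun u => (V (0, u)).2) c

/-! ### The class of dicritical foliations with given involutions -/

/-- `w` defines a foliation of the class `D_q(I)`: it is dicritical of order `m + 1`, the points
of tangency of its blow-up with the exceptional divisor are the simple tangencies `(0, q_j)`, and
near `(0, q_j)` the involution `I_j` exchanges the two points of intersection of a leaf with the
divisor (`f` is a local first integral). -/
structure MemD {m : ℕ} (q : Fin m → ℂ) (I : Fin m → ℂ → ℂ)
    (w : ℂ × ℂ → ℂ × ℂ) : Prop where
  germ : IsFoliationGerm (m + 1) w
  dicritical : ∃ c : ℂ, c ≠ 0 ∧ ∀ a : ℂ × ℂ,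
    homPart (m + 1) (fun z => (w z).1) a = a.1 * (c * ∏ j, (a.2 - q j * a.1)) ∧
    homPart (m + 1) (fun z => (w z).2) a = a.2 * (c * ∏ j, (a.2 - q j * a.1))
  regular : ∀ j, blowUp (m + 1) w (0, q j) ≠ 0
  invol_analytic : ∀ j, AnalyticAt ℂ (I j) (q j)
  invol_fix : ∀ j, I j (q j) = q j
  invol_deriv : ∀ j, deriv (I j) (q j) = -1
  invol_invol : ∀ j, ∀ᶠ u in 𝓝 (q j), I j (I j u) = u
  invol_leaf : ∀ j, ∃ f : ℂ × ℂ → ℂ, AnalyticAt ℂ f (0, q j) ∧ fderiv ℂ f (0, q j) ≠ 0 ∧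
    (∀ᶠ z in 𝓝 ((0 : ℂ), q j), fderiv ℂ f z (blowUp (m + 1) w z) = 0) ∧
    ∀ᶠ u in 𝓝 (q j), f (0, I j u) = f (0, u)

/-! ### Local models, normalizing transformations, factorization equations -/

/-- The objects entering local models and normalizing transformations: `lam i = λ_i`, `s i`,
`z j`, the involutions `I j`, the maps `H_n`, `H_{p_i}`, `H_{q_j}`, the first components
`eps i = ε_i` of `ξ_i = (ε_i, u)` and `sig j = ς_j` of `ζ_j = (ς_j, u)`, and the second components
`phi j` of `Φ_j = (x, φ_j)`. The conditions on them are in `IsNormalizing`. -/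
structure NormalizingData (n m : ℕ) where
  lam : Fin (n + 1) → ℂ
  s : Fin (n + 1) → ℂ → ℂ
  z : Fin m → ℂ → ℂ
  I : Fin m → ℂ → ℂ
  Hn : ℂ × ℂ → ℂ × ℂ
  Hp : Fin (n + 1) → ℂ × ℂ → ℂ × ℂ
  Hq : Fin m → ℂ × ℂ → ℂ × ℂ
  eps : Fin (n + 1) → ℂ × ℂ → ℂ
  sig : Fin m → ℂ × ℂ → ℂ
  phi : Fin m → ℂ × ℂ → ℂ

namespace NormalizingData

variable {n m : ℕ} (D : NormalizingData n m) (p : Fin (n + 1) → ℂ) (q : Fin m → ℂ)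

/-- `g_j(u) = (q_j - u) (I_j(u) - q_j)`. -/
def g (j : Fin m) (u : ℂ) : ℂ := (q j - u) * (D.I j u - q j)

/-- `Ψ_i = (x (1 + s_i(x) / (u - p_i))^{λ_i}, u + s_i(x))`. -/
def Psi (i : Fin (n + 1)) (z : ℂ × ℂ) : ℂ × ℂ :=
  (z.1 * (1 + D.s i z.1 / (z.2 - p i)) ^ D.lam i, z.2 + D.s i z.1)

/-- `ξ_i = (ε_i, u)`. -/
def xi (i : Fin (n + 1)) (z : ℂ × ℂ) : ℂ × ℂ := (D.eps i z, z.2)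

/-- `Φ_j = (x, φ_j)`. -/
def Phi (j : Fin m) (z : ℂ × ℂ) : ℂ × ℂ := (z.1, D.phi j z)

/-- `ζ_j = (ς_j, u)`. -/
def zeta (j : Fin m) (z : ℂ × ℂ) : ℂ × ℂ := (D.sig j z, z.2)

/-- The linear field `λ_i x ∂/∂x + (u - p_i) ∂/∂u`. -/
def linField (i : Fin (n + 1)) (z : ℂ × ℂ) : ℂ × ℂ := (D.lam i * z.1, z.2 - p i)

/-- A field defining the foliation `u + s_i(x) = cst`. -/
def modelGp (i : Fin (n + 1)) (z : ℂ × ℂ) : ℂ × ℂ := (1, -deriv (D.s i) z.1)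

/-- A field defining the foliation `z_j(x) + g_j(u) = cst`. -/
def modelGq (j : Fin m) (z : ℂ × ℂ) : ℂ × ℂ := (deriv (D.g q j) z.2, -deriv (D.z j) z.1)

/-- The exceptional divisor without the points `p_i`, `q_j`, in the chart `(x, u)`. -/
def puncturedDivisor : Set (ℂ × ℂ) := {z | z.1 = 0 ∧ (∀ i, z.2 ≠ p i) ∧ ∀ j, z.2 ≠ q j}

/-- `D` consists of local models and normalizing transformations, with respect to the pair
(`Fμ`, radial foliation), of the pair of foliations defined by the fields `F`, `G`. -/
structure IsNormalizing (F G Fμ : ℂ × ℂ → ℂ × ℂ) : Prop where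
  lam_eq : ∀ i, D.lam i = camachoSad (blowUp (n - 1) Fμ) (p i)
  s_analytic : ∀ i, AnalyticAt ℂ (D.s i) 0
  s_zero : ∀ i, D.s i 0 = 0
  z_analytic : ∀ j, AnalyticAt ℂ (D.z j) 0
  z_zero : ∀ j, D.z j 0 = 0
  z_deriv : ∀ j, deriv (D.z j) 0 ≠ 0
  /-- `H_n` is a biholomorphism between neighbourhoods of the punctured divisor,
  `H_n (x, u) = (x + O(x^2), u + O(x))`. -/
  Hn_biholomorphism : ∃ U : Set (ℂ × ℂ), IsOpen U ∧ puncturedDivisor p q ⊆ U ∧ InjOn D.Hn U ∧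
    ∀ z ∈ U, IsLocalBiholomorphism D.Hn z
  Hn_divisor : ∀ z ∈ puncturedDivisor p q, D.Hn z = z
  Hn_tangent : ∀ z ∈ puncturedDivisor p q, coeffX 1 (fun y => (D.Hn y).1) z.2 = 1
  /-- In the chart `(1 / u, x u)`, `H_n` extends to a biholomorphism at the point `u = ∞` of the
  divisor. -/
  Hn_infinity : ∃ K : ℂ × ℂ → ℂ × ℂ, IsLocalBiholomorphism K 0 ∧ K 0 = 0 ∧
    ∀ᶠ y in 𝓝 (0 : ℂ × ℂ), y.1 ≠ 0 → (K y).1 ≠ 0 →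
      K y = ((D.Hn (y.1 * y.2, y.1⁻¹)).2⁻¹,
        (D.Hn (y.1 * y.2, y.1⁻¹)).1 * (D.Hn (y.1 * y.2, y.1⁻¹)).2)
  Hn_F : MapsFoliation D.Hn (blowUp (n - 1) Fμ) (blowUp (n - 1) F) (puncturedDivisor p q)
  Hn_G : MapsFoliation D.Hn (blowUp 1 radial) (blowUp (m + 1) G) (puncturedDivisor p q)
  Hp_biholomorphism : ∀ i, IsLocalBiholomorphism (D.Hp i) (0, p i)
  Hp_divisor : ∀ i, ∀ᶠ u in 𝓝 (p i), D.Hp i (0, u) = (0, u)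
  Hp_F : ∀ i, MapsFoliation (D.Hp i) (D.linField p i) (blowUp (n - 1) F) {(0, p i)}
  Hp_G : ∀ i, MapsFoliation (D.Hp i) (D.modelGp i) (blowUp (m + 1) G) {(0, p i)}
  Hq_biholomorphism : ∀ j, IsLocalBiholomorphism (D.Hq j) (0, q j)
  Hq_divisor : ∀ j, ∀ᶠ u in 𝓝 (q j), D.Hq j (0, u) = (0, u)
  Hq_F : ∀ j, MapsFoliation (D.Hq j) (fun _ => (0, 1)) (blowUp (n - 1) F) {(0, q j)}
  Hq_G : ∀ j, MapsFoliation (D.Hq j) (D.modelGq q j) (blowUp (m + 1) G) {(0, q j)}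
  /-- `ξ_i` takes the linear foliation to the blow-up of `Fμ`, and is normalized. -/
  eps_analytic : ∀ i, AnalyticAt ℂ (D.eps i) (0, p i)
  eps_divisor : ∀ i, ∀ᶠ u in 𝓝 (p i), D.eps i (0, u) = 0
  eps_one : ∀ i, coeffX 1 (D.eps i) (p i) = 1
  eps_F : ∀ i, MapsFoliation (D.xi i) (D.linField p i) (blowUp (n - 1) Fμ) {(0, p i)}
  /-- `ζ_j` takes the foliation `x = cst` to the blow-up of `Fμ`, and is normalized. -/
  sig_analytic : ∀ j, AnalyticAt ℂ (D.sig j) (0, q j)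
  sig_divisor : ∀ j, ∀ᶠ u in 𝓝 (q j), D.sig j (0, u) = 0
  sig_one : ∀ j, coeffX 1 (D.sig j) (q j) = 1
  sig_higher : ∀ j, ∀ k, 2 ≤ k → coeffX k (D.sig j) (q j) = 0
  sig_F : ∀ j, MapsFoliation (D.zeta j) (fun _ => (0, 1)) (blowUp (n - 1) Fμ) {(0, q j)}
  /-- `g_j (φ_j (x, u)) = g_j (u) + z_j (x)` and `φ_j (0, u) = u`, near the punctured disc. -/
  phi_spec : ∀ j, ∀ᶠ u in 𝓝[≠] (q j), AnalyticAt ℂ (D.phi j) (0, u) ∧ D.phi j (0, u) = u ∧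
    ∀ᶠ y in 𝓝 ((0 : ℂ), u), D.g q j (D.phi j y) = D.g q j y.2 + D.z j y.1
  /-- The factorization equations, near the punctured discs. -/
  factor_p : ∀ i, ∀ᶠ u in 𝓝[≠] (p i), ∀ᶠ y in 𝓝 ((0 : ℂ), u),
    D.Hp i y = D.Hn (D.xi i (D.Psi p i y))
  factor_q : ∀ j, ∀ᶠ u in 𝓝[≠] (q j), ∀ᶠ y in 𝓝 ((0 : ℂ), u),
    D.Hq j y = D.Hn (D.zeta j (D.Phi j y))

/-! ### The canonical solutions and the normal form -/

/-- The term `𝐀_{p_i,k}`: what remains of the coefficient of `x^k` in `A ∘ ξ_i ∘ Ψ_i` after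
removing `ε_{i,k}`, where `A` is the sum of the terms of order `< k` of the first component. -/
def resAp (k : ℕ) (A : ℂ × ℂ → ℂ) (i : Fin (n + 1)) (u : ℂ) : ℂ :=
  coeffX k (fun y => A (D.xi i (D.Psi p i y))) u - coeffX k (D.eps i) u

/-- The term `𝐀_{q_j,k}`. -/
def resAq (k : ℕ) (A : ℂ × ℂ → ℂ) (j : Fin m) (u : ℂ) : ℂ :=
  coeffX k (fun y => A (D.zeta j (D.Phi j y))) u - coeffX k (D.sig j) u

/-- `a_{n,k}` for `k ≥ 2`, in terms of the sum `A` of the terms of order `< k`. -/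
def nextA (k : ℕ) (A : ℂ × ℂ → ℂ) (u : ℂ) : ℂ :=
  - (∑ i, principalPart (fun t => D.resAp p k A i t / coeffX 1 (D.eps i) t ^ k) (p i) u)
  - ∑ j, principalPart (fun t => D.resAq k A j t / coeffX 1 (D.sig j) t ^ k) (q j) u

/-- `truncA k = ∑_{r=1}^k a_{n,r}(u) x^r`. -/
def truncA : ℕ → ℂ × ℂ → ℂ
  | 0 => fun _ => 0
  | 1 => fun y => y.1
  | k + 2 => fun y => truncA (k + 1) y + D.nextA p q (k + 2) (truncA (k + 1)) y.2 * y.1 ^ (k + 2)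

/-- `a_{n,k}` (`a_{n,1} = 1`). -/
def aN : ℕ → ℂ → ℂ
  | 0 => fun _ => 0
  | 1 => fun _ => 1
  | k + 2 => D.nextA p q (k + 2) (D.truncA p q (k + 1))

/-- `a_{p_i,k}` (`a_{p_i,1} = ε_{i,1}`). -/
def aP (k : ℕ) (i : Fin (n + 1)) (u : ℂ) : ℂ :=
  if k = 1 then coeffX 1 (D.eps i) u
  else coeffX k (D.eps i) u + D.resAp p k (D.truncA p q (k - 1)) i u
    + coeffX 1 (D.eps i) u ^ k * D.aN p q k u

/-- `a_{q_j,k}` (`a_{q_j,1} = ς_{j,1}`). -/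
def aQ (k : ℕ) (j : Fin m) (u : ℂ) : ℂ :=
  if k = 1 then coeffX 1 (D.sig j) u
  else coeffX k (D.sig j) u + D.resAq k (D.truncA p q (k - 1)) j u
    + coeffX 1 (D.sig j) u ^ k * D.aN p q k u

/-- `b_{n,1}`. -/
def bOne (u : ℂ) : ℂ :=
  - ∑ j, principalPart
      (fun t => taylorCoeff 1 (D.z j) 0 / (coeffX 1 (D.sig j) t * deriv (D.g q j) t)) (q j) u

/-- The term `𝐁_{p_i,k}`, `k ≥ 2`: what remains of the coefficient of `x^k` in `B ∘ ξ_i ∘ Ψ_i`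
after removing `s_{i,k}` and `ε_{i,k} b_{n,1}`, where `B` is the sum of the terms of order `< k` of
the second component. -/
def resBp (k : ℕ) (B : ℂ × ℂ → ℂ) (i : Fin (n + 1)) (u : ℂ) : ℂ :=
  coeffX k (fun y => B (D.xi i (D.Psi p i y))) u - taylorCoeff k (D.s i) 0
    - coeffX k (D.eps i) u * D.bOne q u

/-- The term `𝐁_{q_j,k}`, `k ≥ 2`. -/
def resBq (k : ℕ) (B : ℂ × ℂ → ℂ) (j : Fin m) (u : ℂ) : ℂ :=
  coeffX k (fun y => B (D.zeta j (D.Phi j y))) u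
    - taylorCoeff k (D.z j) 0 / deriv (D.g q j) u - coeffX k (D.sig j) u * D.bOne q u

/-- `b_{n,k}` for `k ≥ 2`, in terms of the sum `B` of the terms of order `< k`. -/
def nextB (k : ℕ) (B : ℂ × ℂ → ℂ) (u : ℂ) : ℂ :=
  - (∑ i, principalPart (fun t => D.resBp p q k B i t / coeffX 1 (D.eps i) t ^ k) (p i) u)
  - ∑ j, principalPart
      (fun t => taylorCoeff k (D.z j) 0 / (coeffX 1 (D.sig j) t ^ k * deriv (D.g q j) t)
        + D.resBq q k B j t / coeffX 1 (D.sig j) t ^ k) (q j) u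

/-- `truncB k = u + ∑_{r=1}^k b_{n,r}(u) x^r`. -/
def truncB : ℕ → ℂ × ℂ → ℂ
  | 0 => fun y => y.2
  | 1 => fun y => y.2 + D.bOne q y.2 * y.1
  | k + 2 => fun y => truncB (k + 1) y + D.nextB p q (k + 2) (truncB (k + 1)) y.2 * y.1 ^ (k + 2)

/-- `b_{n,k}`. -/
def bN : ℕ → ℂ → ℂ
  | 0 => fun _ => 0
  | 1 => D.bOne q
  | k + 2 => D.nextB p q (k + 2) (D.truncB p q (k + 1))

/-- `b_{p_i,k}`. -/
def bP (k : ℕ) (i : Fin (n + 1)) (u : ℂ) : ℂ :=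
  if k = 1 then taylorCoeff 1 (D.s i) 0 + coeffX 1 (D.eps i) u * D.bOne q u
  else taylorCoeff k (D.s i) 0 + coeffX k (D.eps i) u * D.bOne q u
    + D.resBp p q k (D.truncB p q (k - 1)) i u + coeffX 1 (D.eps i) u ^ k * D.bN p q k u

/-- `b_{q_j,k}`. -/
def bQ (k : ℕ) (j : Fin m) (u : ℂ) : ℂ :=
  if k = 1 then taylorCoeff 1 (D.z j) 0 / deriv (D.g q j) u + coeffX 1 (D.sig j) u * D.bOne q u
  else taylorCoeff k (D.z j) 0 / deriv (D.g q j) u + coeffX k (D.sig j) u * D.bOne q u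
    + D.resBq q k (D.truncB p q (k - 1)) j u + coeffX 1 (D.sig j) u ^ k * D.bN p q k u

/-- The normalizing transformations are in `k₀`-normal form: up to order `k₀`, the coefficients of
their expansions in powers of `x` are the canonical ones (on the punctured divisor, respectively
near `p_i` and `q_j`, where the formulas for `a_{p_i,k}`, … have removable singularities). -/
structure InNormalForm (k₀ : ℕ) : Prop where
  n_first : ∀ k, 1 ≤ k → k ≤ k₀ → ∀ u, (∀ i, u ≠ p i) → (∀ j, u ≠ q j) →
    coeffX k (fun y => (D.Hn y).1) u = D.aN p q k u
  n_second : ∀ k, 1 ≤ k → k ≤ k₀ → ∀ u, (∀ i, u ≠ p i) → (∀ j, u ≠ q j) →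
    coeffX k (fun y => (D.Hn y).2) u = D.bN p q k u
  p_first : ∀ k, 1 ≤ k → k ≤ k₀ → ∀ i, ∀ᶠ u in 𝓝[≠] (p i),
    coeffX k (fun y => (D.Hp i y).1) u = D.aP p q k i u
  p_second : ∀ k, 1 ≤ k → k ≤ k₀ → ∀ i, ∀ᶠ u in 𝓝[≠] (p i),
    coeffX k (fun y => (D.Hp i y).2) u = D.bP p q k i u
  q_first : ∀ k, 1 ≤ k → k ≤ k₀ → ∀ j, ∀ᶠ u in 𝓝[≠] (q j),
    coeffX k (fun y => (D.Hq j y).1) u = D.aQ p q k j u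
  q_second : ∀ k, 1 ≤ k → k ≤ k₀ → ∀ j, ∀ᶠ u in 𝓝[≠] (q j),
    coeffX k (fun y => (D.Hq j y).2) u = D.bQ p q k j u

end NormalizingData

/-! ### The data of lower order -/

/-- The possible values of the data of order `≤ k - 1`: the numbers `λ_i`, `s_{i,r}`, `z_{j,r}`
and the germs of `g_j`, `ε_{i,r}`, `ς_{j,r}`, for all `i`, `j` and `1 ≤ r ≤ k - 1`
(the index `r : Fin (k - 1)` stands for the order `r + 1`). -/
structure LowerData {n m : ℕ} (p : Fin (n + 1) → ℂ) (q : Fin m → ℂ) (k : ℕ) where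
  lam : Fin (n + 1) → ℂ
  s : Fin (n + 1) → Fin (k - 1) → ℂ
  z : Fin m → Fin (k - 1) → ℂ
  g : (j : Fin m) → Germ (𝓝 (q j)) ℂ
  eps : (i : Fin (n + 1)) → Fin (k - 1) → Germ (𝓝 (p i)) ℂ
  sig : (j : Fin m) → Fin (k - 1) → Germ (𝓝 (q j)) ℂ

/-- The data of order `≤ k - 1` of `D`. -/
def NormalizingData.lowerData {n m : ℕ} (D : NormalizingData n m) (p : Fin (n + 1) → ℂ)
    (q : Fin m → ℂ) (k : ℕ) : LowerData p q k where
  lam := D.lam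
  s i r := taylorCoeff (r + 1) (D.s i) 0
  z j r := taylorCoeff (r + 1) (D.z j) 0
  g j := ((D.g q j : ℂ → ℂ) : Germ (𝓝 (q j)) ℂ)
  eps i r := ((coeffX (r + 1) (D.eps i) : ℂ → ℂ) : Germ (𝓝 (p i)) ℂ)
  sig j r := ((coeffX (r + 1) (D.sig j) : ℂ → ℂ) : Germ (𝓝 (q j)) ℂ)

/-- Near `(0, c)` the tangency locus of `V` and `W` is the graph of the holomorphic germ
`x ↦ π(x)`, `π(0) = c`. -/
def IsTangencyBranch (V W : ℂ × ℂ → ℂ × ℂ) (c : ℂ) (π : ℂ → ℂ) : Prop :=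
  AnalyticAt ℂ π 0 ∧ π 0 = c ∧ ∀ᶠ y in 𝓝 ((0 : ℂ), c), y ∈ tangencyLocus V W ↔ y.2 = π y.1

end TangencyCurves

end

open TangencyCurves

/-!
The curve of tangencies of the two foliations is the image, under `H_{p_i}` or `H_{q_j}`, of the
curve of tangencies of the local models, which is `u = p_i - λ_i x s_i'(x)`, respectively
`u = q_j`. These transformations are tangent to the identity, so `c_{·,k}` depends only on their
`k`-jets and on the `k`-jet of the model curve.

Fix the data of order `< k` and the germ `ε_{i,k}` (or `ς_{j,k}`), and vary the rest. The
coefficients of order `< k`, and the coefficient of order `k` of the first component, do not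
change. The coefficient `b_{n,k}` changes by `-∑ⱼ Δz_{j,k} / (2 (u - q_j))`: the remaining terms
depend on data of lower order, and `z_{j,k} / (ς_{j,1}^k g_j')` has a simple pole at `q_j`, of
residue `z_{j,k} / 2` because `g_j''(q_j) = 2`. Letting `u` tend to `p_i` or `q_j` in
`b_{p_i,k}` or `b_{q_j,k}`, and adding the contribution `-k λ_i Δs_{i,k}` of the model curve at
`p_i`, one sees that `c_{·,k}` changes exactly as the explicit term of the formula does. Their
difference is therefore a function of the fixed data, which is the functional transformation; it
vanishes for `k = 1`, where the formulas for `b_{p_i,1}` and `b_{q_j,1}` are explicit.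
-/

noncomputable section

namespace TangencyCurves

open Asymptotics

/-! ### Taylor coefficients in one variable -/

section TaylorCoeff

variable {f g : ℂ → ℂ} {c : ℂ} {k : ℕ}

lemma taylorCoeff_congr (h : f =ᶠ[𝓝 c] g) : taylorCoeff k f c = taylorCoeff k g c := by
  rw [taylorCoeff, taylorCoeff, h.iteratedDeriv_eq]

lemma taylorCoeff_zero (f : ℂ → ℂ) (c : ℂ) : taylorCoeff 0 f c = f c := by
  simp [taylorCoeff]

lemma taylorCoeff_one (f : ℂ → ℂ) (c : ℂ) : taylorCoeff 1 f c = deriv f c := by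
  simp [taylorCoeff]

lemma taylorCoeff_succ (k : ℕ) (f : ℂ → ℂ) (c : ℂ) :
    taylorCoeff (k + 1) f c = taylorCoeff k (deriv f) c / (k + 1) := by
  rw [taylorCoeff, taylorCoeff, iteratedDeriv_succ', Nat.factorial_succ, div_div]
  push_cast
  ring

lemma taylorCoeff_deriv (k : ℕ) (f : ℂ → ℂ) (c : ℂ) :
    taylorCoeff k (deriv f) c = (k + 1) * taylorCoeff (k + 1) f c := by
  rw [taylorCoeff_succ, mul_div_cancel₀ _ k.cast_add_one_ne_zero]

lemma taylorCoeff_sub (hf : AnalyticAt ℂ f c) (hg : AnalyticAt ℂ g c) :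
    taylorCoeff k (fun x => f x - g x) c = taylorCoeff k f c - taylorCoeff k g c := by
  rw [taylorCoeff, iteratedDeriv_fun_sub hf.contDiffAt hg.contDiffAt, sub_div]
  rfl

lemma taylorCoeff_mul_pow (r k : ℕ) (c : ℂ) :
    taylorCoeff r (fun x => c * x ^ k) 0 = if r = k then c else 0 := by
  rw [taylorCoeff, iteratedDeriv_const_mul_field, iteratedDeriv_fun_pow_zero]
  split_ifs with h
  · rw [h, mul_div_cancel_right₀ _ (Nat.cast_ne_zero.2 k.factorial_ne_zero)]
  · simp

lemma isLittleO_pow_iff_natCast_lt_analyticOrderAt (hf : AnalyticAt ℂ f 0) :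
    (f =o[𝓝 0] fun x => x ^ k) ↔ k < analyticOrderAt f 0 := by
  constructor
  · intro hfo
    by_contra! hle
    obtain ⟨r, hr⟩ := ENat.ne_top_iff_exists.1 (ne_top_of_le_ne_top (ENat.natCast_ne_top k) hle)
    have hrk : r ≤ k := by exact_mod_cast hr ▸ hle
    obtain ⟨h, hh, hh0, hfh⟩ := hf.analyticOrderAt_eq_natCast.1 hr.symm
    have hpow : (fun x : ℂ => x ^ k) =O[𝓝 0] fun x => x ^ r := by
      refine .of_bound' ?_
      filter_upwards [Metric.closedBall_mem_nhds (0 : ℂ) one_pos] with x hx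
      simpa using pow_le_pow_of_le_one (norm_nonneg x) (by simpa using hx) hrk
    have hlim : (fun x => x ^ r * h x) =o[𝓝 0] fun x => x ^ r :=
      (hfo.trans_isBigO hpow).congr' (hfh.mono fun x hx => by simpa using hx) .rfl
    have h0 : Tendsto h (𝓝[≠] 0) (𝓝 0) := by
      refine (hlim.mono nhdsWithin_le_nhds).tendsto_div_nhds_zero.congr' ?_
      filter_upwards [self_mem_nhdsWithin] with x hx
      rw [mul_div_cancel_left₀ _ (pow_ne_zero r hx)]
    exact hh0 (tendsto_nhds_unique (hh.continuousAt.tendsto.mono_left nhdsWithin_le_nhds) h0)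
  · intro hlt
    obtain ⟨h, hh, hfh⟩ := (natCast_le_analyticOrderAt hf (n := k + 1)).1
      (by exact_mod_cast Order.add_one_le_of_lt hlt)
    have hb : h =O[𝓝 0] fun _ => (1 : ℂ) := hh.continuousAt.tendsto.isBigO_one ℂ
    refine IsLittleO.congr' ((isLittleO_pow_pow (𝕜 := ℂ) k.lt_succ_self).mul_isBigO hb)
      (hfh.mono fun x hx => by simpa using hx.symm) (.of_forall fun x => by simp)

lemma isLittleO_pow_iff_taylorCoeff_eq_zero (hf : AnalyticAt ℂ f 0) :
    (f =o[𝓝 0] fun x => x ^ k) ↔ ∀ r ≤ k, taylorCoeff r f 0 = 0 := by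
  have hcoeff (r : ℕ) : taylorCoeff r f 0 = 0 ↔ iteratedDeriv r f 0 = 0 := by
    simp [taylorCoeff, Nat.factorial_ne_zero]
  rw [isLittleO_pow_iff_natCast_lt_analyticOrderAt hf,
    ← ENat.add_one_le_iff (ENat.natCast_ne_top k)]
  simp only [hcoeff, ← Nat.lt_succ_iff]
  exact_mod_cast natCast_le_analyticOrderAt_iff_iteratedDeriv_eq_zero hf (n := k + 1)

end TaylorCoeff

/-! ### Differences of jets -/

lemma isEquivalent_of_hasDerivAt_one {X : ℂ → ℂ} (hX : HasDerivAt X 1 0) (hX0 : X 0 = 0) :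
    IsEquivalent (𝓝 0) X fun x => x := by
  simpa [IsEquivalent, Pi.sub_def, hX0] using hX.isLittleO

/-- `f - g = c x ^ k + o(x ^ k)` at `0`: the jets of `f` and `g` agree up to order `k - 1`, and `c`
is the difference of their coefficients of order `k`. No regularity is assumed, so that the relation
can be pushed through compositions before anything is known to be analytic. -/
def HasJetDiff {E : Type*} [NormedAddCommGroup E] [NormedSpace ℂ E]
    (k : ℕ) (f g : ℂ → E) (c : E) : Prop :=
  (fun x => f x - g x - x ^ k • c) =o[𝓝 0] fun x => x ^ k

namespace HasJetDiff

variable {E F : Type*} [NormedAddCommGroup E] [NormedSpace ℂ E]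
  [NormedAddCommGroup F] [NormedSpace ℂ F] {k : ℕ} {f g h : ℂ → E} {c d : E}

lemma refl (k : ℕ) (f : ℂ → E) : HasJetDiff k f f 0 := by
  simp [HasJetDiff]

lemma trans (hfg : HasJetDiff k f g c) (hgh : HasJetDiff k g h d) : HasJetDiff k f h (c + d) :=
  (IsLittleO.add hfg hgh).congr_left fun x => by rw [smul_add]; abel

lemma symm (hfg : HasJetDiff k f g c) : HasJetDiff k g f (-c) :=
  (IsLittleO.neg_left hfg).congr_left fun x => by rw [smul_neg]; abel

lemma congr {f' g' : ℂ → E} (hfg : HasJetDiff k f g c) (hf : f =ᶠ[𝓝 0] f') (hg : g =ᶠ[𝓝 0] g') :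
    HasJetDiff k f' g' c :=
  hfg.congr' (by filter_upwards [hf, hg] with x hx hx'; rw [hx, hx']) .rfl

lemma isBigO_sub (hfg : HasJetDiff k f g c) : (fun x => f x - g x) =O[𝓝 0] fun x => x ^ k :=
  have hc : (fun x : ℂ => x ^ k • c) =O[𝓝 0] fun x => x ^ k :=
    .of_bound ‖c‖ (.of_forall fun x => by rw [norm_smul, mul_comm])
  (IsLittleO.isBigO hfg |>.add hc).congr_left fun x => by abel

lemma prodMk {f' g' : ℂ → F} {d : F} (hfg : HasJetDiff k f g c) (hfg' : HasJetDiff k f' g' d) :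
    HasJetDiff k (fun x => (f x, f' x)) (fun x => (g x, g' x)) (c, d) :=
  IsLittleO.prod_left hfg hfg'

lemma comp {Φ : E → F} {Φ' : E →L[ℂ] F} {a : E} (hfg : HasJetDiff k f g c)
    (hΦ : HasStrictFDerivAt Φ Φ' a) (hf : Tendsto f (𝓝 0) (𝓝 a)) (hg : Tendsto g (𝓝 0) (𝓝 a)) :
    HasJetDiff k (fun x => Φ (f x)) (fun x => Φ (g x)) (Φ' c) := by
  have hlin := (hΦ.isLittleO.comp_tendsto (hf.prodMk_nhds hg)).trans_isBigO hfg.isBigO_sub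
  refine (hlin.add ((Φ'.isBigO_comp _ _).trans_isLittleO hfg)).congr_left fun x => ?_
  simp

lemma comp_deriv {f g : ℂ → ℂ} {c : ℂ} {ρ : ℂ → ℂ} {ρ' a : ℂ} (hfg : HasJetDiff k f g c)
    (hρ : HasStrictDerivAt ρ ρ' a) (hf : Tendsto f (𝓝 0) (𝓝 a)) (hg : Tendsto g (𝓝 0) (𝓝 a)) :
    HasJetDiff k (fun x => ρ (f x)) (fun x => ρ (g x)) (c * ρ') := by
  simpa using hfg.comp hρ.hasStrictFDerivAt hf hg

lemma of_comp {ρ v v' : ℂ → ℂ} {a b ζ : ℂ} (hρ : HasStrictDerivAt ρ b a) (hb : b ≠ 0)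
    (hv : Tendsto v (𝓝 0) (𝓝 a)) (hv' : Tendsto v' (𝓝 0) (𝓝 a))
    (h : HasJetDiff k (fun x => ρ (v x)) (fun x => ρ (v' x)) ζ) : HasJetDiff k v v' (ζ / b) := by
  have hleft := hρ.eventually_left_inverse hb
  have hlim := hρ.hasDerivAt.continuousAt.tendsto
  rw [div_eq_mul_inv]
  exact (h.comp_deriv (hρ.to_localInverse hb) (hlim.comp hv) (hlim.comp hv')).congr
    (hv.eventually hleft) (hv'.eventually hleft)

lemma of_comp_right {X : ℂ → ℂ} (hX : HasStrictDerivAt X 1 0) (hX0 : X 0 = 0)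
    (h : HasJetDiff k (fun x => f (X x)) (fun x => g (X x)) c) : HasJetDiff k f g c := by
  have hmap : map X (𝓝 0) = 𝓝 0 := by simpa [hX0] using hX.map_nhds_eq one_ne_zero
  have hequiv : IsEquivalent (𝓝 0) (fun x => X x ^ k) fun x => x ^ k :=
    (isEquivalent_of_hasDerivAt_one hX.hasDerivAt hX0).pow k
  rw [HasJetDiff, ← hmap, isLittleO_map]
  have hc : (fun x => (x ^ k - X x ^ k) • c) =o[𝓝 0] fun x => x ^ k := by
    refine IsBigO.trans_isLittleO (.of_bound ‖c‖ (.of_forall fun x => ?_)) hequiv.isLittleO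
    rw [norm_smul, Pi.sub_apply, norm_sub_rev, mul_comm]
  refine ((IsLittleO.add h hc).trans_isBigO hequiv.symm.isBigO).congr_left fun x => ?_
  simp only [Function.comp_apply, sub_smul]
  abel

end HasJetDiff

section JetDiffTaylor

variable {k : ℕ} {f g : ℂ → ℂ} {c : ℂ}

lemma hasJetDiff_iff_taylorCoeff (hf : AnalyticAt ℂ f 0) (hg : AnalyticAt ℂ g 0) :
    HasJetDiff k f g c ↔ (∀ r < k, taylorCoeff r f 0 = taylorCoeff r g 0) ∧
      taylorCoeff k f 0 - taylorCoeff k g 0 = c := by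
  have hpow : AnalyticAt ℂ (fun x : ℂ => c * x ^ k) 0 := by fun_prop
  have hcoeff (r : ℕ) : taylorCoeff r (fun x => f x - g x - x ^ k • c) 0 =
      taylorCoeff r f 0 - taylorCoeff r g 0 - if r = k then c else 0 := by
    simp only [smul_eq_mul, mul_comm _ c]
    rw [taylorCoeff_sub (hf.fun_sub hg) hpow, taylorCoeff_sub hf hg, taylorCoeff_mul_pow]
  rw [HasJetDiff, isLittleO_pow_iff_taylorCoeff_eq_zero (by fun_prop)]
  simp only [hcoeff]
  constructor
  · intro H
    exact ⟨fun r hr => by simpa [hr.ne, sub_eq_zero] using H r hr.le,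
      by simpa [sub_eq_zero] using H k le_rfl⟩
  · rintro ⟨hlow, htop⟩ r hr
    rcases hr.lt_or_eq with hr | rfl
    · simp [hlow r hr, hr.ne]
    · simp [htop]

lemma HasJetDiff.taylorCoeff_sub (h : HasJetDiff k f g c) (hf : AnalyticAt ℂ f 0)
    (hg : AnalyticAt ℂ g 0) : taylorCoeff k f 0 - taylorCoeff k g 0 = c :=
  ((hasJetDiff_iff_taylorCoeff hf hg).1 h).2

lemma hasJetDiff_of_taylorCoeff_eq (hf : AnalyticAt ℂ f 0) (hg : AnalyticAt ℂ g 0)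
    (h : ∀ r < k, taylorCoeff r f 0 = taylorCoeff r g 0) :
    HasJetDiff k f g (taylorCoeff k f 0 - taylorCoeff k g 0) :=
  (hasJetDiff_iff_taylorCoeff hf hg).2 ⟨h, rfl⟩

lemma hasJetDiff_deriv (h : HasJetDiff (k + 1) f g c) (hf : AnalyticAt ℂ f 0)
    (hg : AnalyticAt ℂ g 0) : HasJetDiff k (deriv f) (deriv g) ((k + 1) * c) := by
  obtain ⟨hlt, htop⟩ := (hasJetDiff_iff_taylorCoeff hf hg).1 h
  refine (hasJetDiff_iff_taylorCoeff hf.deriv hg.deriv).2 ⟨fun r hr => ?_, ?_⟩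
  · rw [taylorCoeff_deriv, taylorCoeff_deriv, hlt _ (Nat.succ_lt_succ hr)]
  · rw [taylorCoeff_deriv, taylorCoeff_deriv, ← mul_sub, htop]

lemma HasJetDiff.id_mul (h : HasJetDiff k f g c) :
    HasJetDiff (k + 1) (fun x => x * f x) (fun x => x * g x) c :=
  ((isBigO_refl (fun x : ℂ => x) (𝓝 0)).mul_isLittleO h).congr
    (fun x => by simp only [smul_eq_mul]; ring) fun x => (pow_succ' x k).symm

lemma HasJetDiff.of_graph {π π' X X' U U' : ℂ → ℂ} (hπ' : AnalyticAt ℂ π' 0)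
    (hX : HasStrictDerivAt X 1 0) (hX0 : X 0 = 0) (hX' : Tendsto X' (𝓝 0) (𝓝 0))
    (hXX' : HasJetDiff k X X' 0) (hπX : ∀ᶠ x in 𝓝 0, π (X x) = U x)
    (hπX' : ∀ᶠ x in 𝓝 0, π' (X' x) = U' x) (hU : HasJetDiff k U U' c) : HasJetDiff k π π' c := by
  have hX_tendsto : Tendsto X (𝓝 0) (𝓝 0) := by
    simpa [hX0] using hX.hasDerivAt.continuousAt.tendsto
  have hUX : HasJetDiff k U' (fun x => π' (X x)) 0 := by
    simpa using (hXX'.symm.comp_deriv hπ'.hasStrictDerivAt hX' hX_tendsto).congr hπX' .rfl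
  refine .of_comp_right hX hX0 ?_
  simpa using (hU.trans hUX).congr (hπX.mono fun x hx => hx.symm) .rfl

end JetDiffTaylor

/-! ### Expansions along `x = 0` in two variables -/

/-- The partial derivative with respect to the first variable, which shifts the coefficients
`coeffX k F`. -/
def derivX (F : ℂ × ℂ → ℂ) (y : ℂ × ℂ) : ℂ := fderiv ℂ F y (1, 0)

section CoeffX

variable {F G : ℂ × ℂ → ℂ} {u : ℂ} {k : ℕ}

lemma analyticAt_derivX {y : ℂ × ℂ} (hF : AnalyticAt ℂ F y) : AnalyticAt ℂ (derivX F) y :=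
  ((ContinuousLinearMap.apply ℂ ℂ ((1 : ℂ), (0 : ℂ))).analyticAt _).comp hF.fderiv

lemma hasDerivAt_derivX {x v : ℂ} (hF : AnalyticAt ℂ F (x, v)) :
    HasDerivAt (fun t => F (t, v)) (derivX F (x, v)) x :=
  hF.differentiableAt.hasFDerivAt.comp_hasDerivAt x
    ((hasDerivAt_id x).prodMk (hasDerivAt_const x v))

lemma tendsto_prodMk_zero (u : ℂ) : Tendsto (fun v : ℂ => ((0 : ℂ), v)) (𝓝 u) (𝓝 (0, u)) :=
  Continuous.tendsto' (by fun_prop) _ _ rfl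

lemma coeffX_zero (F : ℂ × ℂ → ℂ) (u : ℂ) : coeffX 0 F u = F (0, u) := taylorCoeff_zero _ _

lemma coeffX_succ (hF : AnalyticAt ℂ F (0, u)) (k : ℕ) :
    coeffX (k + 1) F u = coeffX k (derivX F) u / (k + 1) := by
  rw [coeffX, taylorCoeff_succ, coeffX, taylorCoeff_congr]
  have hline : Tendsto (fun x : ℂ => (x, u)) (𝓝 0) (𝓝 (0, u)) :=
    Continuous.tendsto' (by fun_prop) _ _ rfl
  filter_upwards [hline.eventually hF.eventually_analyticAt] with x hx
  exact (hasDerivAt_derivX hx).deriv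

lemma coeffX_one (hF : AnalyticAt ℂ F (0, u)) : coeffX 1 F u = derivX F (0, u) := by
  simp [coeffX_succ hF 0, coeffX_zero]

lemma analyticAt_coeffX (hF : AnalyticAt ℂ F (0, u)) (k : ℕ) : AnalyticAt ℂ (coeffX k F) u := by
  induction k generalizing F with
  | zero =>
    simp only [funext (coeffX_zero F)]
    exact hF.comp_of_eq (f := fun v => ((0 : ℂ), v)) (by fun_prop) rfl
  | succ k ih =>
    refine ((ih (analyticAt_derivX hF)).div_const (c := (k : ℂ) + 1)).congr ?_
    filter_upwards [(tendsto_prodMk_zero u).eventually hF.eventually_analyticAt] with v hv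
    exact (coeffX_succ hv k).symm

lemma coeffX_sub (hF : AnalyticAt ℂ F (0, u)) (hG : AnalyticAt ℂ G (0, u)) :
    coeffX k (fun y => F y - G y) u = coeffX k F u - coeffX k G u :=
  taylorCoeff_sub (hF.comp_of_eq (f := fun x => (x, u)) (by fun_prop) rfl)
    (hG.comp_of_eq (f := fun x => (x, u)) (by fun_prop) rfl)

lemma fderiv_eq_coeffX_one_add (hF : AnalyticAt ℂ F (0, u)) (a : ℂ × ℂ) :
    fderiv ℂ F (0, u) a = a.1 * coeffX 1 F u + a.2 * deriv (coeffX 0 F) u := by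
  have hsnd : HasDerivAt (coeffX 0 F) (fderiv ℂ F (0, u) (0, 1)) u := by
    simp only [funext (coeffX_zero F)]
    exact hF.differentiableAt.hasFDerivAt.comp_hasDerivAt u
      ((hasDerivAt_const u 0).prodMk (hasDerivAt_id u))
  have ha : a = a.1 • ((1 : ℂ), (0 : ℂ)) + a.2 • ((0 : ℂ), (1 : ℂ)) := by simp
  rw [ha, map_add, map_smul, map_smul, hsnd.deriv, coeffX_one hF]
  simp [derivX]

/-- Integration in `x`, locally uniformly in the second variable. -/
lemma isLittleO_pow_succ_of_derivX (hF : AnalyticAt ℂ F (0, u)) (h0 : ∀ᶠ v in 𝓝 u, F (0, v) = 0)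
    (h : derivX F =o[𝓝 (0, u)] fun y => y.1 ^ k) : F =o[𝓝 (0, u)] fun y => y.1 ^ (k + 1) := by
  refine isLittleO_iff.2 fun C hC => ?_
  obtain ⟨δ, hδ, hball⟩ := Metric.eventually_nhds_iff_ball.1
    ((isLittleO_iff.1 h hC).and hF.eventually_analyticAt)
  have hsnd : Tendsto Prod.snd (𝓝 ((0 : ℂ), u)) (𝓝 u) := continuous_snd.tendsto _
  filter_upwards [Metric.ball_mem_nhds _ hδ, hsnd.eventually h0] with ⟨x, v⟩ hxv hv
  have hmem : ∀ t ∈ Metric.closedBall (0 : ℂ) ‖x‖, (t, v) ∈ Metric.ball ((0 : ℂ), u) δ := by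
    simp only [Metric.mem_ball, Prod.dist_eq, max_lt_iff, dist_zero_right,
      Metric.mem_closedBall] at hxv ⊢
    exact fun t ht => ⟨ht.trans_lt hxv.1, hxv.2⟩
  have hbound : ∀ t ∈ Metric.closedBall (0 : ℂ) ‖x‖, ‖derivX F (t, v)‖ ≤ C * ‖x‖ ^ k := by
    intro t ht
    refine (hball _ (hmem t ht)).1.trans ?_
    rw [norm_pow]
    have := mem_closedBall_zero_iff.1 ht
    gcongr
  have hmvt := Convex.norm_image_sub_le_of_norm_hasDerivWithin_le
    (fun t ht => (hasDerivAt_derivX (hball _ (hmem t ht)).2).hasDerivWithinAt) hbound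
    (convex_closedBall 0 ‖x‖) (x := 0) (y := x) (by simp) (by simp)
  simpa [hv, pow_succ, mul_assoc] using hmvt

lemma isLittleO_sub_coeffX_mul_pow (hF : AnalyticAt ℂ F (0, u))
    (h : ∀ r < k, coeffX r F =ᶠ[𝓝 u] 0) :
    (fun y => F y - coeffX k F u * y.1 ^ k) =o[𝓝 (0, u)] fun y => y.1 ^ k := by
  induction k generalizing F with
  | zero =>
    simpa [coeffX_zero, isLittleO_one_iff] using hF.continuousAt.tendsto.sub_const (F (0, u))
  | succ k ih =>
    have hk : (k : ℂ) + 1 ≠ 0 := by exact_mod_cast k.succ_ne_zero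
    have hderiv : ∀ r < k, coeffX r (derivX F) =ᶠ[𝓝 u] 0 := by
      intro r hr
      have hr' : (r : ℂ) + 1 ≠ 0 := by exact_mod_cast r.succ_ne_zero
      filter_upwards [h (r + 1) (by omega),
        (tendsto_prodMk_zero u).eventually hF.eventually_analyticAt] with v hv hFv
      simpa [coeffX_succ hFv, hr'] using hv
    have hpow : AnalyticAt ℂ (fun y : ℂ × ℂ => coeffX (k + 1) F u * y.1 ^ (k + 1)) (0, u) :=
      analyticAt_const.mul (analyticAt_fst.pow _)
    refine isLittleO_pow_succ_of_derivX (hF.fun_sub hpow) ?_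
      ((ih (analyticAt_derivX hF) hderiv).congr' ?_ .rfl)
    · filter_upwards [h 0 k.succ_pos] with v hv
      simpa [coeffX_zero] using hv
    · filter_upwards [hF.eventually_analyticAt] with ⟨x, v⟩ hy
      have hy' := (hasDerivAt_derivX hy).fun_sub
        ((hasDerivAt_pow (k + 1) x).const_mul (coeffX (k + 1) F u))
      have hsub : AnalyticAt ℂ (fun y => F y - coeffX (k + 1) F u * y.1 ^ (k + 1)) (x, v) :=
        hy.fun_sub (analyticAt_const.mul (analyticAt_fst.pow _))
      rw [(hasDerivAt_derivX hsub).unique hy', coeffX_succ hF]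
      push_cast
      field_simp

lemma HasJetDiff.comp_of_coeffX_eq {f g : ℂ → ℂ × ℂ} {c : ℂ × ℂ} (hfg : HasJetDiff k f g c)
    (hF : AnalyticAt ℂ F (0, u)) (hG : AnalyticAt ℂ G (0, u))
    (hFG : ∀ r < k, coeffX r F =ᶠ[𝓝 u] coeffX r G) (hf : Tendsto f (𝓝 0) (𝓝 (0, u)))
    (hg : Tendsto g (𝓝 0) (𝓝 (0, u))) (hg1 : IsEquivalent (𝓝 0) (fun x => (g x).1) fun x => x) :
    HasJetDiff k (fun x => F (f x)) (fun x => G (g x))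
      (c.1 * coeffX 1 F u + c.2 * deriv (coeffX 0 F) u + (coeffX k F u - coeffX k G u)) := by
  rw [← fderiv_eq_coeffX_one_add hF]
  refine (hfg.comp hF.hasStrictFDerivAt hf hg).trans ?_
  have hdiff : ∀ r < k, coeffX r (fun y => F y - G y) =ᶠ[𝓝 u] 0 := by
    intro r hr
    filter_upwards [hFG r hr, (tendsto_prodMk_zero u).eventually hF.eventually_analyticAt,
      (tendsto_prodMk_zero u).eventually hG.eventually_analyticAt] with v hv hFv hGv
    simp [coeffX_sub hFv hGv, hv]
  have hcurve := (isLittleO_sub_coeffX_mul_pow (hF.fun_sub hG) hdiff).comp_tendsto hg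
  have hpow := hg1.pow k
  rw [coeffX_sub hF hG] at hcurve
  refine ((hcurve.trans_isBigO hpow.isBigO).add
    (hpow.isLittleO.const_mul_left (coeffX k F u - coeffX k G u))).congr_left fun x => ?_
  simp only [Function.comp_apply, Pi.sub_apply, Pi.pow_apply, smul_eq_mul]
  ring

end CoeffX

/-! ### Principal parts -/

section PrincipalPart

variable {f g : ℂ → ℂ} {a : ℂ} {P Q : Polynomial ℂ}

lemma isPrincipalPart_congr (h : f =ᶠ[𝓝[≠] a] g) (P : Polynomial ℂ) :
    IsPrincipalPart f a P ↔ IsPrincipalPart g a P := by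
  refine and_congr_right fun _ => exists_congr fun r => and_congr_right fun _ =>
    eventually_congr ?_
  filter_upwards [h] with u hu
  rw [hu]

lemma principalPart_congr (h : f =ᶠ[𝓝[≠] a] g) : principalPart f a = principalPart g a := by
  have hfg : IsPrincipalPart f a = IsPrincipalPart g a :=
    funext fun P => propext (isPrincipalPart_congr h P)
  rw [principalPart, principalPart, hfg]

lemma exists_isPrincipalPart (hf : MeromorphicAt f a) : ∃ P, IsPrincipalPart f a P := by
  obtain ⟨N, hN⟩ := hf
  let G : ℂ → ℂ := fun w => w ^ N * f (w + a)
  have hG : AnalyticAt ℂ G 0 := by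
    simpa [G, Function.comp_def] using
      hN.comp_of_eq (f := fun w : ℂ => w + a) (x := 0) (by fun_prop) (zero_add a)
  obtain ⟨R, hR, hGR⟩ := hG.exists_eq_sum_add_pow_mul N
  refine ⟨∑ i ∈ Finset.range N,
    Polynomial.C (iteratedDeriv i G 0 / (i ! : ℂ)) * Polynomial.X ^ (N - i), ?_,
    fun u => R (u - a), hR.comp_of_eq (f := fun u => u - a) (by fun_prop) (sub_self a), ?_⟩
  · rw [Polynomial.finsetSum_coeff]
    refine Finset.sum_eq_zero fun i hi => ?_
    simp [Polynomial.coeff_X_pow, (Nat.sub_pos_of_lt (Finset.mem_range.1 hi)).ne]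
  · filter_upwards [self_mem_nhdsWithin] with u hu
    have hua : u - a ≠ 0 := sub_ne_zero.2 hu
    have hGu : G (u - a) = (u - a) ^ N * f u := by simp [G]
    rw [← mul_right_inj' (pow_ne_zero N hua), ← hGu, hGR, Polynomial.eval_finsetSum, mul_add,
      Finset.mul_sum]
    congr 1
    refine Finset.sum_congr rfl fun i hi => ?_
    simp only [Polynomial.eval_mul, Polynomial.eval_C, Polynomial.eval_pow, Polynomial.eval_X,
      inv_pow, smul_eq_mul]
    rw [← pow_mul_pow_sub (u - a) (Finset.mem_range.1 hi).le]
    field_simp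

/-- A non-constant polynomial in `(u - a)⁻¹` is unbounded near `a`. -/
lemma eq_zero_of_eval_inv_eventuallyEq {r : ℂ → ℂ} (h0 : P.coeff 0 = 0) (hr : ContinuousAt r a)
    (h : ∀ᶠ u in 𝓝[≠] a, P.eval (u - a)⁻¹ = r u) : P = 0 := by
  by_contra hP
  have hdeg : 0 < P.degree := by
    by_contra! hle
    rw [Polynomial.eq_C_of_degree_le_zero hle, h0, map_zero] at hP
    exact hP rfl
  have hsub : Tendsto (fun u : ℂ => u - a) (𝓝[≠] a) (𝓝[≠] 0) := by
    refine tendsto_nhdsWithin_iff.2 ⟨?_, ?_⟩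
    · exact (Continuous.tendsto' (f := fun u : ℂ => u - a) (by fun_prop) _ _
        (sub_self a)).mono_left nhdsWithin_le_nhds
    · filter_upwards [self_mem_nhdsWithin] with u hu using sub_ne_zero.2 hu
  have hunbounded := P.tendsto_norm_atTop hdeg
    (tendsto_norm_cobounded_atTop.comp (tendsto_inv₀_nhdsNE_zero.comp hsub))
  refine not_tendsto_nhds_of_tendsto_atTop hunbounded ‖r a‖
    ((hr.norm.tendsto.mono_left nhdsWithin_le_nhds).congr' ?_)
  filter_upwards [h] with u hu
  simp [hu]

lemma IsPrincipalPart.unique (hP : IsPrincipalPart f a P) (hQ : IsPrincipalPart f a Q) :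
    P = Q := by
  obtain ⟨hP0, r, hr, hPr⟩ := hP
  obtain ⟨hQ0, s, hs, hQs⟩ := hQ
  rw [← sub_eq_zero]
  refine eq_zero_of_eval_inv_eventuallyEq (a := a) (r := fun u => s u - r u)
    (by simp [hP0, hQ0]) (hs.continuousAt.sub hr.continuousAt) ?_
  filter_upwards [hPr, hQs] with u hu hu'
  rw [Polynomial.eval_sub]
  linear_combination hu' - hu

lemma IsPrincipalPart.sub (hP : IsPrincipalPart f a P) (hQ : IsPrincipalPart g a Q) :
    IsPrincipalPart (fun u => f u - g u) a (P - Q) := by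
  obtain ⟨hP0, r, hr, hPr⟩ := hP
  obtain ⟨hQ0, s, hs, hQs⟩ := hQ
  refine ⟨by simp [hP0, hQ0], fun u => r u - s u, hr.sub hs, ?_⟩
  filter_upwards [hPr, hQs] with u hu hu'
  rw [hu, hu', Polynomial.eval_sub]
  ring

lemma IsPrincipalPart.principalPart_eq (hP : IsPrincipalPart f a P) :
    principalPart f a = fun u => P.eval (u - a)⁻¹ := by
  have h : ∃ P, IsPrincipalPart f a P := ⟨P, hP⟩
  rw [principalPart, dif_pos h, h.choose_spec.unique hP]

lemma principalPart_sub (hf : MeromorphicAt f a) (hg : MeromorphicAt g a) (u : ℂ) :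
    principalPart (fun t => f t - g t) a u = principalPart f a u - principalPart g a u := by
  obtain ⟨P, hP⟩ := exists_isPrincipalPart hf
  obtain ⟨Q, hQ⟩ := exists_isPrincipalPart hg
  rw [hP.principalPart_eq, hQ.principalPart_eq, (hP.sub hQ).principalPart_eq]
  simp

lemma principalPart_eq_eval (f : ℂ → ℂ) (a : ℂ) :
    ∃ P : Polynomial ℂ, principalPart f a = fun u => P.eval (u - a)⁻¹ := by
  by_cases h : ∃ P, IsPrincipalPart f a P
  · exact ⟨_, h.choose_spec.principalPart_eq⟩
  · exact ⟨0, by rw [principalPart, dif_neg h]; ext; simp⟩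

lemma analyticAt_principalPart (f : ℂ → ℂ) {u : ℂ} (hu : u ≠ a) :
    AnalyticAt ℂ (principalPart f a) u := by
  obtain ⟨P, hP⟩ := principalPart_eq_eval f a
  rw [hP]
  simp only [Polynomial.eval_eq_sum_range]
  exact Finset.analyticAt_fun_sum _ fun i _ => analyticAt_const.mul
    (((analyticAt_id.sub analyticAt_const).inv (sub_ne_zero.2 hu)).pow i)

lemma meromorphicAt_principalPart (f : ℂ → ℂ) (a u : ℂ) :
    MeromorphicAt (principalPart f a) u := by
  obtain ⟨P, hP⟩ := principalPart_eq_eval f a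
  rw [hP]
  simp only [Polynomial.eval_eq_sum_range]
  exact MeromorphicAt.fun_sum fun i _ => (MeromorphicAt.const _ _).mul
    (((MeromorphicAt.id u).sub (MeromorphicAt.const a u)).inv.pow i)

lemma principalPart_simplePole {h : ℂ → ℂ} (hh : AnalyticAt ℂ h a)
    (hf : ∀ᶠ u in 𝓝[≠] a, f u = h u / (u - a)) (u : ℂ) :
    principalPart f a u = h a / (u - a) := by
  have hP : IsPrincipalPart f a (Polynomial.C (h a) * Polynomial.X) := by
    obtain ⟨_, hps⟩ := hh
    refine ⟨by simp, dslope h a, hps.has_fpower_series_dslope_fslope.analyticAt, ?_⟩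
    filter_upwards [hf, self_mem_nhdsWithin] with u hu hua
    have hsub : u - a ≠ 0 := sub_ne_zero.2 hua
    rw [hu, dslope_of_ne _ hua, slope_def_field]
    simp only [Polynomial.eval_mul, Polynomial.eval_C, Polynomial.eval_X]
    field_simp
    ring
  rw [hP.principalPart_eq]
  simp [div_eq_mul_inv]

end PrincipalPart

/-! ### The curve of tangencies -/

/-- The determinant of two vectors of `ℂ²`, whose vanishing defines `tangencyLocus`. -/
def wedge (a b : ℂ × ℂ) : ℂ := a.1 * b.2 - a.2 * b.1

lemma mem_tangencyLocus {V W : ℂ × ℂ → ℂ × ℂ} {y : ℂ × ℂ} :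
    y ∈ tangencyLocus V W ↔ wedge (V y) (W y) = 0 := .rfl

lemma wedge_smul_smul (r t : ℂ) (a b : ℂ × ℂ) : wedge (r • a) (t • b) = r * t * wedge a b := by
  simp only [wedge, Prod.smul_fst, Prod.smul_snd, smul_eq_mul]
  ring

lemma wedge_map (L : ℂ × ℂ →L[ℂ] ℂ × ℂ) (a b : ℂ × ℂ) :
    wedge (L a) (L b) = wedge (L (1, 0)) (L (0, 1)) * wedge a b := by
  have hL (a : ℂ × ℂ) : L a = a.1 • L (1, 0) + a.2 • L (0, 1) := by
    rw [← map_smul, ← map_smul, ← map_add]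
    simp
  rw [hL a, hL b]
  simp only [wedge, Prod.fst_add, Prod.snd_add, Prod.smul_fst, Prod.smul_snd, smul_eq_mul]
  ring

lemma wedge_map_basis_ne_zero {L : ℂ × ℂ →L[ℂ] ℂ × ℂ} (hL : L.IsInvertible) :
    wedge (L (1, 0)) (L (0, 1)) ≠ 0 := by
  obtain ⟨e, rfl⟩ := hL
  intro h
  have hsymm := wedge_map e.symm (e (1, 0)) (e (0, 1))
  simp only [ContinuousLinearEquiv.coe_coe, ContinuousLinearEquiv.symm_apply_apply] at h hsymm
  rw [h, mul_zero] at hsymm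
  simp [wedge] at hsymm

lemma eventually_map_mem_tangencyLocus_iff {H X Y V W : ℂ × ℂ → ℂ × ℂ} {y₀ : ℂ × ℂ}
    (hH : IsLocalBiholomorphism H y₀) (hX : MapsFoliation H X V {y₀})
    (hY : MapsFoliation H Y W {y₀}) :
    ∀ᶠ y in 𝓝 y₀, H y ∈ tangencyLocus V W ↔ y ∈ tangencyLocus X Y := by
  obtain ⟨hH, e, he⟩ := hH
  obtain ⟨f, hf, hf0, hfX⟩ := hX
  obtain ⟨g, hg, hg0, hgY⟩ := hY
  rw [nhdsSet_singleton] at hfX hgY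
  have hinvertible : ∀ᶠ y in 𝓝 y₀, (fderiv ℂ H y).IsInvertible :=
    hH.fderiv.continuousAt.eventually_mem (he ▸ e.nhds)
  filter_upwards [hfX, hgY, hinvertible, (hf _ rfl).continuousAt.eventually_ne (hf0 _ rfl),
    (hg _ rfl).continuousAt.eventually_ne (hg0 _ rfl)] with y hfy hgy hHy hf0y hg0y
  have hdet := wedge_map (fderiv ℂ H y) (X y) (Y y)
  rw [hfy, hgy, wedge_smul_smul] at hdet
  rw [mem_tangencyLocus, mem_tangencyLocus,
    ← mul_eq_zero_iff_left (mul_ne_zero hf0y hg0y), hdet,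
    mul_eq_zero_iff_left (wedge_map_basis_ne_zero hHy)]

section FixedDivisor

variable {H : ℂ × ℂ → ℂ × ℂ} {c : ℂ} {w : ℂ → ℂ}

lemma fderiv_apply_of_fixes_divisor (hH : AnalyticAt ℂ H (0, c))
    (hdiv : ∀ᶠ u in 𝓝 c, H (0, u) = (0, u)) : fderiv ℂ H (0, c) (0, 1) = (0, 1) := by
  have hline : HasDerivAt (fun u : ℂ => ((0 : ℂ), u)) (0, 1) c :=
    (hasDerivAt_const c 0).prodMk (hasDerivAt_id c)
  exact (hH.differentiableAt.hasFDerivAt.comp_hasDerivAt c hline).unique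
    (hline.congr_of_eventuallyEq hdiv)

lemma fderiv_fst_ne_zero_of_fixes_divisor (hH : IsLocalBiholomorphism H (0, c))
    (hdiv : ∀ᶠ u in 𝓝 c, H (0, u) = (0, u)) : (fderiv ℂ H (0, c) (1, 0)).1 ≠ 0 := by
  have hwedge := wedge_map_basis_ne_zero hH.2
  rwa [fderiv_apply_of_fixes_divisor hH.1 hdiv, wedge, mul_one, mul_zero, sub_zero] at hwedge

lemma hasStrictDerivAt_fst_comp_graph (hH : AnalyticAt ℂ H (0, c))
    (hdiv : ∀ᶠ u in 𝓝 c, H (0, u) = (0, u)) (hw : AnalyticAt ℂ w 0) (hw0 : w 0 = c) :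
    HasStrictDerivAt (fun x => (H (x, w x)).1) (fderiv ℂ H (0, c) (1, 0)).1 0 := by
  have hcurve : HasStrictDerivAt (fun x => (x, w x)) (1, deriv w 0) 0 :=
    (hasStrictDerivAt_id 0).prodMk hw.hasStrictDerivAt
  have hbasis : ((1 : ℂ), deriv w 0) = (1, 0) + deriv w 0 • ((0 : ℂ), (1 : ℂ)) := by simp
  have hcomp := (hw0 ▸ hH.hasStrictFDerivAt).comp_hasStrictDerivAt_of_eq 0 hcurve rfl
  refine ((ContinuousLinearMap.fst ℂ ℂ ℂ).hasStrictFDerivAt.comp_hasStrictDerivAt 0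
    hcomp).congr_deriv ?_
  rw [hbasis, map_add, map_smul, hw0, fderiv_apply_of_fixes_divisor hH hdiv]
  simp

lemma exists_analyticAt_graph_iff (hH : IsLocalBiholomorphism H (0, c))
    (hdiv : ∀ᶠ u in 𝓝 c, H (0, u) = (0, u)) (hw : AnalyticAt ℂ w 0) (hw0 : w 0 = c) :
    ∃ π : ℂ → ℂ, AnalyticAt ℂ π 0 ∧ π 0 = c ∧
      ∀ᶠ y in 𝓝 ((0 : ℂ), c), (H y).2 = π (H y).1 ↔ y.2 = w y.1 := by
  let X : ℂ → ℂ := fun x => (H (x, w x)).1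
  have hH0 : H (0, c) = (0, c) := hdiv.self_of_nhds
  have hX0 : X 0 = 0 := by simp [X, hw0, hH0]
  have hcurve : AnalyticAt ℂ (fun x => H (x, w x)) 0 :=
    hH.1.comp_of_eq (analyticAt_id.prod hw) (by simp [hw0])
  have hX : AnalyticAt ℂ X 0 := analyticAt_fst.comp hcurve
  have hX' : deriv X 0 ≠ 0 := by
    rw [(hasStrictDerivAt_fst_comp_graph hH.1 hdiv hw hw0).hasDerivAt.deriv]
    exact fderiv_fst_ne_zero_of_fixes_divisor hH hdiv
  let Z := hX.hasStrictDerivAt.localInverse X _ 0 hX'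
  have hZX : ∀ᶠ x in 𝓝 0, Z (X x) = x := hX.hasStrictDerivAt.eventually_left_inverse hX'
  have hXZ : ∀ᶠ t in 𝓝 0, X (Z t) = t := by
    simpa only [hX0] using hX.hasStrictDerivAt.eventually_right_inverse hX'
  have hZ0 : Z 0 = 0 := by simpa only [hX0] using hZX.self_of_nhds
  have hZ : AnalyticAt ℂ Z 0 := by simpa only [hX0] using hX.analyticAt_localInverse hX'
  refine ⟨fun t => (H (Z t, w (Z t))).2,
    (analyticAt_snd.comp hcurve).comp_of_eq hZ hZ0, by simp [hZ0, hw0, hH0], ?_⟩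
  obtain ⟨hHa, e, he⟩ := hH
  have hleft := (he ▸ hHa.hasStrictFDerivAt).eventually_left_inverse
  have hH1 : Tendsto (fun y => (H y).1) (𝓝 (0, c)) (𝓝 0) := by
    simpa [hH0] using hHa.continuousAt.fst.tendsto
  have hback : Tendsto (fun y => (Z (H y).1, w (Z (H y).1))) (𝓝 (0, c)) (𝓝 (0, c)) := by
    have hZw := ((hZ.continuousAt.prodMk
      (hw.continuousAt.comp_of_eq hZ.continuousAt hZ0)).tendsto).comp hH1
    simpa [hZ0, hw0, Function.comp_def] using hZw
  filter_upwards [hleft, hback.eventually hleft, hH1.eventually hXZ,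
    (continuous_fst.tendsto ((0 : ℂ), c)).eventually hZX] with y hy hy' hXZy hZXy
  constructor
  · intro hgraph
    have hsame : H (Z (H y).1, w (Z (H y).1)) = H y := Prod.ext hXZy hgraph.symm
    rw [hsame, hy] at hy'
    rw [hy']
  · intro hgraph
    have hyw : y = (y.1, w y.1) := Prod.ext rfl hgraph
    have hZy : Z (H y).1 = y.1 := by rw [hyw]; exact hZXy
    rw [hZy, ← hyw]

end FixedDivisor

/-- The germ `π` is holomorphic, and its graph is the image under `H` of the graph of `w`. -/
structure IsGraphImage (H : ℂ × ℂ → ℂ × ℂ) (w π : ℂ → ℂ) : Prop where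
  analytic : AnalyticAt ℂ π 0
  apply_eq : ∀ᶠ x in 𝓝 0, π (H (x, w x)).1 = (H (x, w x)).2

lemma exists_isTangencyBranch {H X Y V W : ℂ × ℂ → ℂ × ℂ} {c : ℂ} {w : ℂ → ℂ}
    (hH : IsLocalBiholomorphism H (0, c)) (hdiv : ∀ᶠ u in 𝓝 c, H (0, u) = (0, u))
    (hX : MapsFoliation H X V {(0, c)}) (hY : MapsFoliation H Y W {(0, c)})
    (hw : AnalyticAt ℂ w 0) (hw0 : w 0 = c)
    (hloc : ∀ᶠ y in 𝓝 ((0 : ℂ), c), y ∈ tangencyLocus X Y ↔ y.2 = w y.1) :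
    ∃ π, IsTangencyBranch V W c π ∧ IsGraphImage H w π := by
  obtain ⟨π, hπ, hπ0, hgraph⟩ := exists_analyticAt_graph_iff hH hdiv hw hw0
  obtain ⟨hHa, e, he⟩ := hH
  have hH0 : H (0, c) = (0, c) := hdiv.self_of_nhds
  have hmap : map H (𝓝 (0, c)) = 𝓝 (0, c) := by
    have hstrict : HasStrictFDerivAt H (e : ℂ × ℂ →L[ℂ] ℂ × ℂ) (0, c) :=
      he ▸ hHa.hasStrictFDerivAt
    simpa only [hH0] using hstrict.map_nhds_eq_of_equiv
  have hcurve : Tendsto (fun x => (x, w x)) (𝓝 0) (𝓝 (0, c)) := by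
    simpa [hw0] using (continuousAt_id.prodMk hw.continuousAt).tendsto
  refine ⟨π, ⟨hπ, hπ0, ?_⟩, hπ, (hcurve.eventually hgraph).mono fun x hx => (hx.2 rfl).symm⟩
  rw [← hmap, eventually_map]
  filter_upwards [eventually_map_mem_tangencyLocus_iff ⟨hHa, e, he⟩ hX hY, hloc, hgraph]
    with y hHy hy hgraphy
  rw [hHy, hy, hgraphy]

section SimpleZero

variable {f τ : ℂ → ℂ} {a b : ℂ}

lemma eventuallyEq_of_punctured {g : ℂ → ℂ} (hf : AnalyticAt ℂ f a) (hg : AnalyticAt ℂ g a)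
    (h : f =ᶠ[𝓝[≠] a] g) : f =ᶠ[𝓝 a] g :=
  (hf.frequently_eq_iff_eventually_eq hg).1 h.frequently

lemma eq_of_tendsto_punctured {g : ℂ → ℂ} (hf : ContinuousAt f a) (h : f =ᶠ[𝓝[≠] a] g)
    (hg : Tendsto g (𝓝[≠] a) (𝓝 b)) : f a = b :=
  tendsto_nhds_unique ((hf.tendsto.mono_left nhdsWithin_le_nhds).congr' h) hg

lemma analyticAt_dslope (hf : AnalyticAt ℂ f a) : AnalyticAt ℂ (dslope f a) a := by
  obtain ⟨_, hps⟩ := hf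
  exact hps.has_fpower_series_dslope_fslope.analyticAt

lemma deriv_dslope_same (hf : AnalyticAt ℂ f a) :
    deriv (dslope f a) a = deriv (deriv f) a / 2 := by
  have hd := analyticAt_dslope hf
  have hsub (u : ℂ) : HasDerivAt (fun t => t - a) 1 u := (hasDerivAt_id u).sub_const a
  have hf_eq : f = fun u => f a + (u - a) * dslope f a u := funext fun u => by
    rw [← smul_eq_mul, sub_smul_dslope, add_sub_cancel]
  have hderiv : deriv f =ᶠ[𝓝 a] fun u => dslope f a u + (u - a) * deriv (dslope f a) u := by
    filter_upwards [hd.eventually_analyticAt] with u hu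
    conv_lhs => rw [hf_eq]
    simpa using (((hsub u).fun_mul hu.differentiableAt.hasDerivAt).const_add (f a)).deriv
  rw [hderiv.deriv_eq, (hd.differentiableAt.hasDerivAt.fun_add
    ((hsub a).fun_mul hd.deriv.differentiableAt.hasDerivAt)).deriv]
  ring

lemma eq_sub_mul_dslope (hfa : f a = 0) (u : ℂ) : f u = (u - a) * dslope f a u := by
  rw [← smul_eq_mul, sub_smul_dslope, hfa, sub_zero]

lemma principalPart_const_div (hf : AnalyticAt ℂ f a) (hfa : f a = 0) (hf' : deriv f a ≠ 0)
    (ζ u : ℂ) : principalPart (fun t => ζ / f t) a u = ζ / (deriv f a * (u - a)) := by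
  have hh : AnalyticAt ℂ (fun t => ζ / dslope f a t) a :=
    analyticAt_const.div (analyticAt_dslope hf) (by rwa [dslope_same])
  rw [principalPart_simplePole hh (.of_forall fun t => ?_), dslope_same, div_div]
  rw [eq_sub_mul_dslope hfa, div_div, mul_comm]

lemma tendsto_inv_sub_div (hf : AnalyticAt ℂ f a) (hfa : f a = 0) (hf' : deriv f a = b)
    (hb : b ≠ 0) (hτ : AnalyticAt ℂ τ a) (hτa : τ a = 1) :
    Tendsto (fun u => 1 / f u - τ u / (b * (u - a))) (𝓝[≠] a)
      (𝓝 (-(deriv τ a + deriv (deriv f) a / (2 * b)) / b)) := by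
  have hd := analyticAt_dslope hf
  have hda : dslope f a a = b := by rw [dslope_same, hf']
  have hprod : HasDerivAt (fun u => τ u * dslope f a u)
      (deriv τ a * b + deriv (deriv f) a / 2) a := by
    simpa [hf', hτa, deriv_dslope_same hf] using
      hτ.differentiableAt.hasDerivAt.fun_mul hd.differentiableAt.hasDerivAt
  have hlim := hprod.tendsto_slope.neg.div
    ((hd.continuousAt.tendsto.mono_left nhdsWithin_le_nhds).const_mul b)
    (by rw [hda]; exact mul_ne_zero hb hb)
  have hvalue : -(deriv τ a * b + deriv (deriv f) a / 2) / (b * dslope f a a) =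
      -(deriv τ a + deriv (deriv f) a / (2 * b)) / b := by
    rw [hda]
    field_simp
  rw [hvalue] at hlim
  refine hlim.congr' ?_
  filter_upwards [self_mem_nhdsWithin, (hd.continuousAt.eventually_ne
    (by rwa [hda])).filter_mono nhdsWithin_le_nhds] with u hu hdu
  have hua : u - a ≠ 0 := sub_ne_zero.2 hu
  simp only [Pi.div_apply, slope_def_field, eq_sub_mul_dslope hfa, hτa, hda]
  field_simp
  ring

end SimpleZero

/-! ### Comparison of compositions along `x = 0` -/

/-- The germs `e` and `e'` at `(0, c)` vanish on `x = 0`, and their expansions in powers of `x`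
agree below order `k`. -/
structure AgreeAlongDivisor (k : ℕ) (e e' : ℂ × ℂ → ℂ) (c : ℂ) : Prop where
  analytic : AnalyticAt ℂ e (0, c)
  analytic' : AnalyticAt ℂ e' (0, c)
  zero : ∀ᶠ u in 𝓝 c, e (0, u) = 0
  zero' : ∀ᶠ u in 𝓝 c, e' (0, u) = 0
  coeffX_eq : ∀ r < k, coeffX r e =ᶠ[𝓝 c] coeffX r e'

namespace AgreeAlongDivisor

variable {k : ℕ} {e e' : ℂ × ℂ → ℂ} {u c : ℂ}

lemma of_coeffX_eq (he : AnalyticAt ℂ e (0, c)) (he' : AnalyticAt ℂ e' (0, c))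
    (he0 : ∀ᶠ u in 𝓝 c, e (0, u) = 0) (he0' : ∀ᶠ u in 𝓝 c, e' (0, u) = 0)
    (h : ∀ r, 1 ≤ r → r < k → coeffX r e =ᶠ[𝓝 c] coeffX r e') :
    AgreeAlongDivisor k e e' c := by
  refine ⟨he, he', he0, he0', fun r hr => ?_⟩
  rcases Nat.eq_zero_or_pos r with rfl | hr0
  · filter_upwards [he0, he0'] with u hu hu'
    rw [coeffX_zero, coeffX_zero, hu, hu']
  · exact h r hr0 hr

lemma eventually (h : AgreeAlongDivisor k e e' c) : ∀ᶠ u in 𝓝 c, AgreeAlongDivisor k e e' u := by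
  have hcoeff : ∀ᶠ u in 𝓝 c, ∀ r < k, coeffX r e =ᶠ[𝓝 u] coeffX r e' :=
    (eventually_all_finite (Set.finite_lt_nat k)).2
      fun r hr => eventually_eventuallyEq_nhds.2 (h.coeffX_eq r hr)
  filter_upwards [(tendsto_prodMk_zero c).eventually h.analytic.eventually_analyticAt,
    (tendsto_prodMk_zero c).eventually h.analytic'.eventually_analyticAt,
    h.zero.eventually_nhds, h.zero'.eventually_nhds, hcoeff] with u he he' hzero hzero' hcoeff
  exact ⟨he, he', hzero, hzero', hcoeff⟩

lemma taylorCoeff_comp_sub (h : AgreeAlongDivisor k e e' u) {T : ℂ × ℂ → ℂ}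
    (hT : AnalyticAt ℂ T (0, u)) {γ γ' : ℂ → ℂ × ℂ} (hγ : AnalyticAt ℂ γ 0)
    (hγ' : AnalyticAt ℂ γ' 0) (hγ0 : γ 0 = (0, u)) (hγ0' : γ' 0 = (0, u))
    (hγ1 : IsEquivalent (𝓝 0) (fun x => (γ' x).1) fun x => x) {ν : ℂ}
    (hγγ' : HasJetDiff k γ γ' (0, ν)) :
    taylorCoeff k (fun x => T (e (γ x), (γ x).2)) 0
        - taylorCoeff k (fun x => T (e' (γ' x), (γ' x).2)) 0 =
      (coeffX k e u - coeffX k e' u) * coeffX 1 T u + ν * deriv (coeffX 0 T) u := by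
  have hlim : Tendsto γ (𝓝 0) (𝓝 (0, u)) := hγ0 ▸ hγ.continuousAt.tendsto
  have hlim' : Tendsto γ' (𝓝 0) (𝓝 (0, u)) := hγ0' ▸ hγ'.continuousAt.tendsto
  have he0 : deriv (coeffX 0 e) u = 0 := by
    have : coeffX 0 e =ᶠ[𝓝 u] fun _ => 0 := h.zero.mono fun v hv => (coeffX_zero e v).trans hv
    rw [this.deriv_eq, deriv_const]
  have hfirst : HasJetDiff k (fun x => e (γ x)) (fun x => e' (γ' x))
      (coeffX k e u - coeffX k e' u) := by
    simpa [he0] using hγγ'.comp_of_coeffX_eq h.analytic h.analytic' h.coeffX_eq hlim hlim' hγ1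
  have hsecond : HasJetDiff k (fun x => (γ x).2) (fun x => (γ' x).2) ν :=
    hγγ'.comp hasStrictFDerivAt_snd hlim hlim'
  have hα : AnalyticAt ℂ (fun x => (e (γ x), (γ x).2)) 0 :=
    (h.analytic.comp_of_eq hγ hγ0).prod (analyticAt_snd.comp hγ)
  have hα' : AnalyticAt ℂ (fun x => (e' (γ' x), (γ' x).2)) 0 :=
    (h.analytic'.comp_of_eq hγ' hγ0').prod (analyticAt_snd.comp hγ')
  have hα0 : (e (γ 0), (γ 0).2) = (0, u) := by rw [hγ0, h.zero.self_of_nhds]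
  have hα0' : (e' (γ' 0), (γ' 0).2) = (0, u) := by rw [hγ0', h.zero'.self_of_nhds]
  rw [((hfirst.prodMk hsecond).comp hT.hasStrictFDerivAt (hα0 ▸ hα.continuousAt.tendsto)
    (hα0' ▸ hα'.continuousAt.tendsto)).taylorCoeff_sub (hT.comp_of_eq hα hα0)
    (hT.comp_of_eq hα' hα0'), fderiv_eq_coeffX_one_add hT]

end AgreeAlongDivisor

/-! ### Regular data, and data agreeing below a given order -/

namespace NormalizingData

variable {n m k : ℕ} {D D' : NormalizingData n m} {p : Fin (n + 1) → ℂ} {q : Fin m → ℂ} {u : ℂ}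

/-- The conditions on `D` that do not refer to the foliations: the germs that enter the local
models and the transformations `ξ_i`, `ζ_j`, `Φ_j` are holomorphic and normalized. They are all
that the construction of the canonical coefficients depends on. -/
structure IsRegular (D : NormalizingData n m) (p : Fin (n + 1) → ℂ) (q : Fin m → ℂ) : Prop where
  s_analytic : ∀ i, AnalyticAt ℂ (D.s i) 0
  s_zero : ∀ i, D.s i 0 = 0
  z_analytic : ∀ j, AnalyticAt ℂ (D.z j) 0
  z_zero : ∀ j, D.z j 0 = 0
  eps_analytic : ∀ i, AnalyticAt ℂ (D.eps i) (0, p i)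
  eps_divisor : ∀ i, ∀ᶠ u in 𝓝 (p i), D.eps i (0, u) = 0
  eps_one : ∀ i, coeffX 1 (D.eps i) (p i) = 1
  sig_analytic : ∀ j, AnalyticAt ℂ (D.sig j) (0, q j)
  sig_divisor : ∀ j, ∀ᶠ u in 𝓝 (q j), D.sig j (0, u) = 0
  sig_one : ∀ j, coeffX 1 (D.sig j) (q j) = 1
  phi_spec : ∀ j, ∀ᶠ u in 𝓝[≠] (q j), AnalyticAt ℂ (D.phi j) (0, u) ∧ D.phi j (0, u) = u ∧
    ∀ᶠ y in 𝓝 ((0 : ℂ), u), D.g q j (D.phi j y) = D.g q j y.2 + D.z j y.1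
  invol_analytic : ∀ j, AnalyticAt ℂ (D.I j) (q j)
  invol_fix : ∀ j, D.I j (q j) = q j
  invol_deriv : ∀ j, deriv (D.I j) (q j) = -1

lemma IsNormalizing.isRegular {F G Fμ : ℂ × ℂ → ℂ × ℂ} (h : D.IsNormalizing p q F G Fμ)
    (hI : ∀ j, AnalyticAt ℂ (D.I j) (q j)) (hI0 : ∀ j, D.I j (q j) = q j)
    (hI1 : ∀ j, deriv (D.I j) (q j) = -1) : D.IsRegular p q where
  s_analytic := h.s_analytic
  s_zero := h.s_zero
  z_analytic := h.z_analytic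
  z_zero := h.z_zero
  eps_analytic := h.eps_analytic
  eps_divisor := h.eps_divisor
  eps_one := h.eps_one
  sig_analytic := h.sig_analytic
  sig_divisor := h.sig_divisor
  sig_one := h.sig_one
  phi_spec := h.phi_spec
  invol_analytic := hI
  invol_fix := hI0
  invol_deriv := hI1

namespace IsRegular

variable (h : D.IsRegular p q) (i : Fin (n + 1)) (j : Fin m)
include h

lemma analyticAt_g : AnalyticAt ℂ (D.g q j) (q j) :=
  (analyticAt_const.sub analyticAt_id).mul ((h.invol_analytic j).sub analyticAt_const)

lemma deriv_g_eventuallyEq :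
    deriv (D.g q j) =ᶠ[𝓝 (q j)]
      fun u => (q j - u) * deriv (D.I j) u - (D.I j u - q j) := by
  filter_upwards [(h.invol_analytic j).eventually_analyticAt] with u hu
  have hg : HasDerivAt (D.g q j) (-1 * (D.I j u - q j) + (q j - u) * deriv (D.I j) u) u :=
    ((hasDerivAt_id u).const_sub (q j)).fun_mul (hu.differentiableAt.hasDerivAt.sub_const (q j))
  rw [hg.deriv]
  ring

lemma deriv_g_self : deriv (D.g q j) (q j) = 0 := by
  simp [(h.deriv_g_eventuallyEq j).self_of_nhds, h.invol_fix]

lemma deriv_deriv_g_self : deriv (deriv (D.g q j)) (q j) = 2 := by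
  have hI := h.invol_analytic j
  have hderiv := ((((hasDerivAt_id (q j)).const_sub (q j)).fun_mul
    hI.deriv.differentiableAt.hasDerivAt).fun_sub
      (hI.differentiableAt.hasDerivAt.sub_const (q j))).deriv
  rw [(h.deriv_g_eventuallyEq j).deriv_eq]
  refine hderiv.trans ?_
  norm_num [h.invol_deriv]

lemma eventually_deriv_g_ne_zero : ∀ᶠ u in 𝓝[≠] (q j), deriv (D.g q j) u ≠ 0 := by
  have hderiv := (h.analyticAt_g j).deriv.differentiableAt.hasDerivAt
  rw [h.deriv_deriv_g_self] at hderiv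
  exact hderiv.eventually_ne two_ne_zero

lemma analyticAt_sig_one : AnalyticAt ℂ (coeffX 1 (D.sig j)) (q j) :=
  analyticAt_coeffX (h.sig_analytic j) 1

end IsRegular

/-- `D` and `D'` are regular, and their data of order `< k` agree. -/
structure AgreeBelow (D D' : NormalizingData n m) (p : Fin (n + 1) → ℂ) (q : Fin m → ℂ)
    (k : ℕ) : Prop where
  regular : D.IsRegular p q
  regular' : D'.IsRegular p q
  lam : D.lam = D'.lam
  s : ∀ i r, 1 ≤ r → r < k → taylorCoeff r (D.s i) 0 = taylorCoeff r (D'.s i) 0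
  z : ∀ j r, 1 ≤ r → r < k → taylorCoeff r (D.z j) 0 = taylorCoeff r (D'.z j) 0
  g : ∀ j, D.g q j =ᶠ[𝓝 (q j)] D'.g q j
  eps : ∀ i r, 1 ≤ r → r < k → coeffX r (D.eps i) =ᶠ[𝓝 (p i)] coeffX r (D'.eps i)
  sig : ∀ j r, 1 ≤ r → r < k → coeffX r (D.sig j) =ᶠ[𝓝 (q j)] coeffX r (D'.sig j)

namespace AgreeBelow

lemma of_lowerData_eq (hD : D.IsRegular p q) (hD' : D'.IsRegular p q)
    (h : D.lowerData p q k = D'.lowerData p q k) : AgreeBelow D D' p q k where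
  regular := hD
  regular' := hD'
  lam := congrArg LowerData.lam h
  s i r hr hrk := by
    have hs := congrFun₂ (congrArg LowerData.s h) i ⟨r - 1, by lia⟩
    simpa [lowerData, Nat.sub_add_cancel hr] using hs
  z j r hr hrk := by
    have hz := congrFun₂ (congrArg LowerData.z h) j ⟨r - 1, by lia⟩
    simpa [lowerData, Nat.sub_add_cancel hr] using hz
  g j := Germ.coe_eq.1 (congrFun (congrArg LowerData.g h) j)
  eps i r hr hrk := by
    have heps := congrFun (congrFun (congrArg LowerData.eps h) i) ⟨r - 1, by lia⟩
    simp only [lowerData, Nat.sub_add_cancel hr] at heps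
    exact Germ.coe_eq.1 heps
  sig j r hr hrk := by
    have hsig := congrFun (congrFun (congrArg LowerData.sig h) j) ⟨r - 1, by lia⟩
    simp only [lowerData, Nat.sub_add_cancel hr] at hsig
    exact Germ.coe_eq.1 hsig

lemma mono {l : ℕ} (h : AgreeBelow D D' p q k) (hl : l ≤ k) : AgreeBelow D D' p q l where
  regular := h.regular
  regular' := h.regular'
  lam := h.lam
  s i r hr hrl := h.s i r hr (hrl.trans_le hl)
  z j r hr hrl := h.z j r hr (hrl.trans_le hl)
  g := h.g
  eps i r hr hrl := h.eps i r hr (hrl.trans_le hl)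
  sig j r hr hrl := h.sig j r hr (hrl.trans_le hl)

lemma hasJetDiff_s (h : AgreeBelow D D' p q k) (i : Fin (n + 1)) :
    HasJetDiff k (D.s i) (D'.s i) (taylorCoeff k (D.s i) 0 - taylorCoeff k (D'.s i) 0) := by
  refine hasJetDiff_of_taylorCoeff_eq (h.regular.s_analytic i) (h.regular'.s_analytic i)
    fun r hr => ?_
  rcases Nat.eq_zero_or_pos r with rfl | hr0
  · rw [taylorCoeff_zero, taylorCoeff_zero, h.regular.s_zero, h.regular'.s_zero]
  · exact h.s i r hr0 hr

lemma hasJetDiff_z (h : AgreeBelow D D' p q k) (j : Fin m) :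
    HasJetDiff k (D.z j) (D'.z j) (taylorCoeff k (D.z j) 0 - taylorCoeff k (D'.z j) 0) := by
  refine hasJetDiff_of_taylorCoeff_eq (h.regular.z_analytic j) (h.regular'.z_analytic j)
    fun r hr => ?_
  rcases Nat.eq_zero_or_pos r with rfl | hr0
  · rw [taylorCoeff_zero, taylorCoeff_zero, h.regular.z_zero, h.regular'.z_zero]
  · exact h.z j r hr0 hr

lemma agreeAlongDivisor_eps (h : AgreeBelow D D' p q k) (i : Fin (n + 1)) :
    AgreeAlongDivisor k (D.eps i) (D'.eps i) (p i) :=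
  .of_coeffX_eq (h.regular.eps_analytic i) (h.regular'.eps_analytic i) (h.regular.eps_divisor i)
    (h.regular'.eps_divisor i) (h.eps i)

lemma agreeAlongDivisor_sig (h : AgreeBelow D D' p q k) (j : Fin m) :
    AgreeAlongDivisor k (D.sig j) (D'.sig j) (q j) :=
  .of_coeffX_eq (h.regular.sig_analytic j) (h.regular'.sig_analytic j) (h.regular.sig_divisor j)
    (h.regular'.sig_divisor j) (h.sig j)

end AgreeBelow

/-! ### The canonical coefficients off the points `p_i`, `q_j` -/

/-- The points of the divisor different from all `p_i` and `q_j`, where the coefficients of the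
canonical solutions are holomorphic. -/
def IsOff (p : Fin (n + 1) → ℂ) (q : Fin m → ℂ) (u : ℂ) : Prop :=
  (∀ i, u ≠ p i) ∧ ∀ j, u ≠ q j

lemma eventually_isOff (p : Fin (n + 1) → ℂ) (q : Fin m → ℂ) (c : ℂ) :
    ∀ᶠ u in 𝓝[≠] c, IsOff p q u := by
  have hne (a : ℂ) : ∀ᶠ u in 𝓝[≠] c, u ≠ a := by
    rcases eq_or_ne c a with rfl | hca
    · exact self_mem_nhdsWithin
    · exact eventually_ne_nhdsWithin hca
  exact (eventually_all.2 fun i => hne (p i)).and (eventually_all.2 fun j => hne (q j))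

lemma analyticAt_bOne (hu : IsOff p q u) : AnalyticAt ℂ (D.bOne q) u :=
  (Finset.analyticAt_fun_sum _ fun j _ => analyticAt_principalPart _ (hu.2 j)).neg

lemma meromorphicAt_bOne (u : ℂ) : MeromorphicAt (D.bOne q) u :=
  (MeromorphicAt.fun_sum fun j _ => meromorphicAt_principalPart _ (q j) u).neg

lemma analyticAt_nextA (k : ℕ) (A : ℂ × ℂ → ℂ) (hu : IsOff p q u) :
    AnalyticAt ℂ (D.nextA p q k A) u :=
  (Finset.analyticAt_fun_sum _ fun i _ => analyticAt_principalPart _ (hu.1 i)).neg.sub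
    (Finset.analyticAt_fun_sum _ fun j _ => analyticAt_principalPart _ (hu.2 j))

lemma analyticAt_nextB (k : ℕ) (B : ℂ × ℂ → ℂ) (hu : IsOff p q u) :
    AnalyticAt ℂ (D.nextB p q k B) u :=
  (Finset.analyticAt_fun_sum _ fun i _ => analyticAt_principalPart _ (hu.1 i)).neg.sub
    (Finset.analyticAt_fun_sum _ fun j _ => analyticAt_principalPart _ (hu.2 j))

lemma meromorphicAt_nextB (k : ℕ) (B : ℂ × ℂ → ℂ) (u : ℂ) :
    MeromorphicAt (D.nextB p q k B) u :=
  (MeromorphicAt.fun_sum fun i _ => meromorphicAt_principalPart _ (p i) u).neg.sub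
    (MeromorphicAt.fun_sum fun j _ => meromorphicAt_principalPart _ (q j) u)

lemma analyticAt_truncA (k : ℕ) (hu : IsOff p q u) : AnalyticAt ℂ (D.truncA p q k) (0, u) := by
  induction k with
  | zero => exact analyticAt_const
  | succ k ih =>
    cases k with
    | zero => exact analyticAt_fst
    | succ k =>
      have hnext : AnalyticAt ℂ (fun y : ℂ × ℂ => D.nextA p q (k + 2) (D.truncA p q (k + 1)) y.2)
          (0, u) := (analyticAt_nextA _ _ hu).comp_of_eq analyticAt_snd rfl
      exact ih.fun_add (hnext.fun_mul (analyticAt_fst.fun_pow (k + 2)))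

lemma analyticAt_truncB (k : ℕ) (hu : IsOff p q u) : AnalyticAt ℂ (D.truncB p q k) (0, u) := by
  induction k with
  | zero => exact analyticAt_snd
  | succ k ih =>
    cases k with
    | zero =>
      have hbOne : AnalyticAt ℂ (fun y : ℂ × ℂ => D.bOne q y.2) (0, u) :=
        (analyticAt_bOne hu).comp_of_eq analyticAt_snd rfl
      exact analyticAt_snd.fun_add (hbOne.fun_mul analyticAt_fst)
    | succ k =>
      have hnext : AnalyticAt ℂ (fun y : ℂ × ℂ => D.nextB p q (k + 2) (D.truncB p q (k + 1)) y.2)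
          (0, u) := (analyticAt_nextB _ _ hu).comp_of_eq analyticAt_snd rfl
      exact ih.fun_add (hnext.fun_mul (analyticAt_fst.fun_pow (k + 2)))

lemma coeffX_zero_truncA (k : ℕ) : coeffX 0 (D.truncA p q k) = 0 := by
  funext u
  rw [coeffX_zero]
  induction k with
  | zero => rfl
  | succ k ih => cases k <;> simp_all [truncA]

lemma coeffX_zero_truncB (k : ℕ) : coeffX 0 (D.truncB p q k) = id := by
  funext u
  rw [coeffX_zero]
  induction k with
  | zero => rfl
  | succ k ih => cases k <;> simp_all [truncB]

lemma coeffX_one_truncA (k : ℕ) (u : ℂ) : coeffX 1 (D.truncA p q (k + 1)) u = 1 := by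
  suffices HasDerivAt (fun x => D.truncA p q (k + 1) (x, u)) 1 0 from
    (taylorCoeff_one _ _).trans this.deriv
  induction k with
  | zero => exact hasDerivAt_id 0
  | succ k ih =>
    refine (ih.fun_add ((hasDerivAt_pow (k + 2) 0).const_mul
      (D.nextA p q (k + 2) (D.truncA p q (k + 1)) u))).congr_deriv ?_
    simp

lemma coeffX_one_truncB (k : ℕ) (u : ℂ) : coeffX 1 (D.truncB p q (k + 1)) u = D.bOne q u := by
  suffices HasDerivAt (fun x => D.truncB p q (k + 1) (x, u)) (D.bOne q u) 0 from
    (taylorCoeff_one _ _).trans this.deriv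
  induction k with
  | zero =>
    exact (((hasDerivAt_id 0).const_mul (D.bOne q u)).const_add u).congr_deriv (mul_one _)
  | succ k ih =>
    refine (ih.fun_add ((hasDerivAt_pow (k + 2) 0).const_mul
      (D.nextB p q (k + 2) (D.truncB p q (k + 1)) u))).congr_deriv ?_
    simp

end NormalizingData

/-! ### Comparison of the transformations of two sets of data -/

namespace NormalizingData

variable {n m k : ℕ} {D D' : NormalizingData n m} {p : Fin (n + 1) → ℂ} {q : Fin m → ℂ} {u : ℂ}
  {T : ℂ × ℂ → ℂ}

lemma analyticAt_one_add_div_cpow (a lam : ℂ) :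
    AnalyticAt ℂ (fun t : ℂ => (1 + t / a) ^ lam) 0 := by
  have hbase : AnalyticAt ℂ (fun t : ℂ => 1 + t / a) 0 := by
    simp only [div_eq_mul_inv]
    fun_prop
  exact hbase.cpow analyticAt_const (by simp)

lemma IsRegular.analyticAt_one_add_s_div_cpow (h : D.IsRegular p q) (i : Fin (n + 1)) (u : ℂ) :
    AnalyticAt ℂ (fun x => (1 + D.s i x / (u - p i)) ^ D.lam i) 0 :=
  (analyticAt_one_add_div_cpow (u - p i) (D.lam i)).comp_of_eq (h.s_analytic i) (h.s_zero i)

lemma IsRegular.analyticAt_Psi (h : D.IsRegular p q) (i : Fin (n + 1)) (u : ℂ) :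
    AnalyticAt ℂ (fun x => D.Psi p i (x, u)) 0 :=
  (analyticAt_id.mul (h.analyticAt_one_add_s_div_cpow i u)).prod
    (analyticAt_const.add (h.s_analytic i))

lemma IsRegular.Psi_zero (h : D.IsRegular p q) (i : Fin (n + 1)) (u : ℂ) :
    D.Psi p i (0, u) = (0, u) := by
  simp [Psi, h.s_zero]

lemma IsRegular.isEquivalent_Psi_fst (h : D.IsRegular p q) (i : Fin (n + 1)) (u : ℂ) :
    IsEquivalent (𝓝 0) (fun x => (D.Psi p i (x, u)).1) fun x => x := by
  refine isEquivalent_of_hasDerivAt_one ?_ (by simp [Psi])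
  exact ((hasDerivAt_id 0).fun_mul
    (h.analyticAt_one_add_s_div_cpow i u).differentiableAt.hasDerivAt).congr_deriv
      (by simp [h.s_zero])

lemma AgreeBelow.hasJetDiff_Psi (h : AgreeBelow D D' p q k) (i : Fin (n + 1)) (u : ℂ) :
    HasJetDiff k (fun x => D.Psi p i (x, u)) (fun x => D'.Psi p i (x, u))
      (0, taylorCoeff k (D.s i) 0 - taylorCoeff k (D'.s i) 0) := by
  have hs := h.hasJetDiff_s i
  have hF : AnalyticAt ℂ (fun y : ℂ × ℂ => y.1 * (1 + y.2 / (u - p i)) ^ D.lam i) (0, 0) :=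
    analyticAt_fst.fun_mul
      ((analyticAt_one_add_div_cpow (u - p i) (D.lam i)).comp_of_eq analyticAt_snd rfl)
  have hlim {E : NormalizingData n m} (hE : E.IsRegular p q) :
      Tendsto (fun x => (x, E.s i x)) (𝓝 0) (𝓝 (0, 0)) := by
    have hcont := continuousAt_id.prodMk (hE.s_analytic i).continuousAt
    simpa [ContinuousAt, hE.s_zero] using hcont
  have hfst := ((HasJetDiff.refl k id).prodMk hs).comp hF.hasStrictFDerivAt (hlim h.regular)
    (hlim h.regular')
  have hF0 : coeffX 0 (fun y : ℂ × ℂ => y.1 * (1 + y.2 / (u - p i)) ^ D.lam i) = fun _ => 0 :=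
    funext fun t => by simp [coeffX_zero]
  rw [fderiv_eq_coeffX_one_add hF, hF0] at hfst
  refine HasJetDiff.prodMk ?_ (by simpa [HasJetDiff] using hs)
  simpa [h.lam] using hfst

lemma AgreeBelow.coeffX_comp_xi_Psi_sub (h : AgreeBelow D D' p q k) (i : Fin (n + 1))
    (hT : ∀ᶠ u in 𝓝[≠] (p i), AnalyticAt ℂ T (0, u)) :
    ∀ᶠ u in 𝓝[≠] (p i), coeffX k (fun y => T (D.xi i (D.Psi p i y))) u
        - coeffX k (fun y => T (D'.xi i (D'.Psi p i y))) u =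
      (coeffX k (D.eps i) u - coeffX k (D'.eps i) u) * coeffX 1 T u
        + (taylorCoeff k (D.s i) 0 - taylorCoeff k (D'.s i) 0) * deriv (coeffX 0 T) u := by
  filter_upwards [hT, (h.agreeAlongDivisor_eps i).eventually.filter_mono nhdsWithin_le_nhds]
    with u hTu hu
  exact hu.taylorCoeff_comp_sub hTu (h.regular.analyticAt_Psi i u) (h.regular'.analyticAt_Psi i u)
    (h.regular.Psi_zero i u) (h.regular'.Psi_zero i u) (h.regular'.isEquivalent_Psi_fst i u)
    (h.hasJetDiff_Psi i u)

lemma AgreeBelow.hasJetDiff_Phi (h : AgreeBelow D D' p q k) (j : Fin m) :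
    ∀ᶠ u in 𝓝[≠] (q j), HasJetDiff k (fun x => D.Phi j (x, u)) (fun x => D'.Phi j (x, u))
      (0, (taylorCoeff k (D.z j) 0 - taylorCoeff k (D'.z j) 0) / deriv (D.g q j) u) := by
  filter_upwards [h.regular.phi_spec j, h.regular'.phi_spec j,
    h.regular.eventually_deriv_g_ne_zero j, (h.g j).eventually_nhds.filter_mono nhdsWithin_le_nhds,
    (h.regular.analyticAt_g j).eventually_analyticAt.filter_mono nhdsWithin_le_nhds]
    with u ⟨hv, hv0, hgv⟩ ⟨hv', hv0', hgv'⟩ hg0 hgg' hg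
  have hx : Tendsto (fun x : ℂ => (x, u)) (𝓝 0) (𝓝 (0, u)) :=
    Continuous.tendsto' (by fun_prop) _ _ rfl
  have hlim : Tendsto (fun x => D.phi j (x, u)) (𝓝 0) (𝓝 u) := by
    simpa only [hv0, Function.comp_def] using hv.continuousAt.tendsto.comp hx
  have hlim' : Tendsto (fun x => D'.phi j (x, u)) (𝓝 0) (𝓝 u) := by
    simpa only [hv0', Function.comp_def] using hv'.continuousAt.tendsto.comp hx
  have hz : HasJetDiff k (fun x => D.g q j u + D.z j x) (fun x => D.g q j u + D'.z j x)
      (taylorCoeff k (D.z j) 0 - taylorCoeff k (D'.z j) 0) := by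
    simpa [HasJetDiff] using h.hasJetDiff_z j
  refine (HasJetDiff.refl k _).prodMk
    (.of_comp hg.hasStrictDerivAt hg0 hlim hlim' (hz.congr ?_ ?_))
  · filter_upwards [hx.eventually hgv] with x hgx using hgx.symm
  · filter_upwards [hx.eventually hgv', hlim'.eventually hgg'] with x hgx hggx
    rw [hggx, hgx, hgg'.self_of_nhds]

lemma AgreeBelow.coeffX_comp_zeta_Phi_sub (h : AgreeBelow D D' p q k) (j : Fin m)
    (hT : ∀ᶠ u in 𝓝[≠] (q j), AnalyticAt ℂ T (0, u)) :
    ∀ᶠ u in 𝓝[≠] (q j), coeffX k (fun y => T (D.zeta j (D.Phi j y))) u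
        - coeffX k (fun y => T (D'.zeta j (D'.Phi j y))) u =
      (coeffX k (D.sig j) u - coeffX k (D'.sig j) u) * coeffX 1 T u
        + (taylorCoeff k (D.z j) 0 - taylorCoeff k (D'.z j) 0) / deriv (D.g q j) u
          * deriv (coeffX 0 T) u := by
  filter_upwards [hT, (h.agreeAlongDivisor_sig j).eventually.filter_mono nhdsWithin_le_nhds,
    h.regular.phi_spec j, h.regular'.phi_spec j, h.hasJetDiff_Phi j]
    with u hTu hu ⟨hv, hv0, _⟩ ⟨hv', hv0', _⟩ hΦ
  have hx : AnalyticAt ℂ (fun x : ℂ => (x, u)) 0 := analyticAt_id.prod analyticAt_const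
  exact hu.taylorCoeff_comp_sub hTu (analyticAt_id.prod (hv.comp_of_eq hx rfl))
    (analyticAt_id.prod (hv'.comp_of_eq hx rfl)) (by simp [hv0]) (by simp [hv0'])
    .refl hΦ

lemma AgreeBelow.deriv_g (h : AgreeBelow D D' p q k) (j : Fin m) :
    deriv (D.g q j) =ᶠ[𝓝[≠] (q j)] deriv (D'.g q j) :=
  (h.g j).deriv.filter_mono nhdsWithin_le_nhds

lemma AgreeBelow.eps_one_punctured (h : AgreeBelow D D' p q k) (hk : 2 ≤ k) (i : Fin (n + 1)) :
    coeffX 1 (D.eps i) =ᶠ[𝓝[≠] (p i)] coeffX 1 (D'.eps i) :=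
  (h.eps i 1 le_rfl hk).filter_mono nhdsWithin_le_nhds

lemma AgreeBelow.sig_one_punctured (h : AgreeBelow D D' p q k) (hk : 2 ≤ k) (j : Fin m) :
    coeffX 1 (D.sig j) =ᶠ[𝓝[≠] (q j)] coeffX 1 (D'.sig j) :=
  (h.sig j 1 le_rfl hk).filter_mono nhdsWithin_le_nhds

lemma AgreeBelow.bOne_eq (h : AgreeBelow D D' p q k) (hk : 2 ≤ k) : D.bOne q = D'.bOne q := by
  funext u
  rw [bOne, bOne]
  congr 1
  refine Finset.sum_congr rfl fun j _ => congrFun (principalPart_congr ?_) u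
  filter_upwards [h.deriv_g j, h.sig_one_punctured hk j] with t hg hσ
  rw [hg, hσ, h.z j 1 le_rfl hk]

lemma AgreeBelow.resAp_eventuallyEq (h : AgreeBelow D D' p q k) (r : ℕ) (i : Fin (n + 1)) :
    D.resAp p k (D.truncA p q (r + 1)) i =ᶠ[𝓝[≠] (p i)]
      D'.resAp p k (D.truncA p q (r + 1)) i := by
  have hT : ∀ᶠ u in 𝓝[≠] (p i), AnalyticAt ℂ (D.truncA p q (r + 1)) (0, u) :=
    (eventually_isOff p q _).mono fun u => analyticAt_truncA _
  filter_upwards [h.coeffX_comp_xi_Psi_sub i hT] with u hu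
  rw [coeffX_one_truncA, coeffX_zero_truncA, deriv_zero, Pi.zero_apply] at hu
  rw [resAp, resAp]
  linear_combination hu

lemma AgreeBelow.resAq_eventuallyEq (h : AgreeBelow D D' p q k) (r : ℕ) (j : Fin m) :
    D.resAq k (D.truncA p q (r + 1)) j =ᶠ[𝓝[≠] (q j)]
      D'.resAq k (D.truncA p q (r + 1)) j := by
  have hT : ∀ᶠ u in 𝓝[≠] (q j), AnalyticAt ℂ (D.truncA p q (r + 1)) (0, u) :=
    (eventually_isOff p q _).mono fun u => analyticAt_truncA _
  filter_upwards [h.coeffX_comp_zeta_Phi_sub j hT] with u hu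
  rw [coeffX_one_truncA, coeffX_zero_truncA, deriv_zero, Pi.zero_apply] at hu
  rw [resAq, resAq]
  linear_combination hu

lemma AgreeBelow.resBp_eventuallyEq (h : AgreeBelow D D' p q k) (hk : 2 ≤ k) (r : ℕ)
    (i : Fin (n + 1)) :
    D.resBp p q k (D.truncB p q (r + 1)) i =ᶠ[𝓝[≠] (p i)]
      D'.resBp p q k (D.truncB p q (r + 1)) i := by
  have hT : ∀ᶠ u in 𝓝[≠] (p i), AnalyticAt ℂ (D.truncB p q (r + 1)) (0, u) :=
    (eventually_isOff p q _).mono fun u => analyticAt_truncB _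
  filter_upwards [h.coeffX_comp_xi_Psi_sub i hT] with u hu
  rw [coeffX_one_truncB, coeffX_zero_truncB, deriv_id] at hu
  rw [resBp, resBp, ← h.bOne_eq hk]
  linear_combination hu

lemma AgreeBelow.resBq_eventuallyEq (h : AgreeBelow D D' p q k) (hk : 2 ≤ k) (r : ℕ)
    (j : Fin m) :
    D.resBq q k (D.truncB p q (r + 1)) j =ᶠ[𝓝[≠] (q j)]
      D'.resBq q k (D.truncB p q (r + 1)) j := by
  have hT : ∀ᶠ u in 𝓝[≠] (q j), AnalyticAt ℂ (D.truncB p q (r + 1)) (0, u) :=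
    (eventually_isOff p q _).mono fun u => analyticAt_truncB _
  filter_upwards [h.deriv_g j, h.coeffX_comp_zeta_Phi_sub j hT] with u hg hu
  rw [coeffX_one_truncB, coeffX_zero_truncB, deriv_id] at hu
  rw [resBq, resBq, ← h.bOne_eq hk, ← hg]
  linear_combination hu

lemma AgreeBelow.nextA_eq (h : AgreeBelow D D' p q k) (hk : 2 ≤ k) (r : ℕ) :
    D.nextA p q k (D.truncA p q (r + 1)) = D'.nextA p q k (D.truncA p q (r + 1)) := by
  funext u
  rw [nextA, nextA]
  congr 1
  · congr 1
    refine Finset.sum_congr rfl fun i _ => congrFun (principalPart_congr ?_) u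
    filter_upwards [h.resAp_eventuallyEq r i, h.eps_one_punctured hk i] with t hres hε
    rw [hres, hε]
  · refine Finset.sum_congr rfl fun j _ => congrFun (principalPart_congr ?_) u
    filter_upwards [h.resAq_eventuallyEq r j, h.sig_one_punctured hk j] with t hres hσ
    rw [hres, hσ]

lemma AgreeBelow.truncA_eq {r : ℕ} (h : AgreeBelow D D' p q k) (hr : r + 2 ≤ k) :
    D.truncA p q (r + 1) = D'.truncA p q (r + 1) := by
  induction r with
  | zero => rfl
  | succ r ih =>
    rw [truncA, truncA, (h.mono (by lia : r + 2 ≤ k)).nextA_eq (by lia), ih (by lia)]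

lemma AgreeBelow.aN_eq (h : AgreeBelow D D' p q k) (hk : 2 ≤ k) : D.aN p q k = D'.aN p q k := by
  obtain ⟨r, rfl⟩ := Nat.exists_eq_add_of_le' hk
  rw [aN, aN, h.nextA_eq hk, h.truncA_eq le_rfl]

lemma AgreeBelow.sum_principalPart_resBp_eq (h : AgreeBelow D D' p q k) (hk : 2 ≤ k) (r : ℕ)
    (u : ℂ) :
    ∑ i, principalPart (fun t => D.resBp p q k (D.truncB p q (r + 1)) i t
        / coeffX 1 (D.eps i) t ^ k) (p i) u =
      ∑ i, principalPart (fun t => D'.resBp p q k (D.truncB p q (r + 1)) i t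
        / coeffX 1 (D'.eps i) t ^ k) (p i) u := by
  refine Finset.sum_congr rfl fun i _ => congrFun (principalPart_congr ?_) u
  filter_upwards [h.resBp_eventuallyEq hk r i, h.eps_one_punctured hk i] with t hres hε
  rw [hres, hε]

lemma AgreeBelow.nextB_eq (h : AgreeBelow D D' p q (k + 1)) (hk : 2 ≤ k) (r : ℕ) :
    D.nextB p q k (D.truncB p q (r + 1)) = D'.nextB p q k (D.truncB p q (r + 1)) := by
  have h' := h.mono k.le_succ
  funext u
  rw [nextB, nextB, h'.sum_principalPart_resBp_eq hk]
  congr 1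
  refine Finset.sum_congr rfl fun j _ => congrFun (principalPart_congr ?_) u
  filter_upwards [h'.resBq_eventuallyEq hk r j, h'.sig_one_punctured hk j, h.deriv_g j]
    with t hres hσ hg
  rw [hres, hσ, hg, h.z j k (by lia) k.lt_succ_self]

lemma AgreeBelow.truncB_eq {r : ℕ} (h : AgreeBelow D D' p q k) (hr : r + 2 ≤ k) :
    D.truncB p q (r + 1) = D'.truncB p q (r + 1) := by
  induction r with
  | zero =>
    funext y
    rw [truncB, truncB, h.bOne_eq hr]
  | succ r ih =>
    rw [truncB, truncB, (h.mono (by lia : r + 2 + 1 ≤ k)).nextB_eq (by lia), ih (by lia)]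

lemma IsRegular.principalPart_div_sig_pow_mul_deriv_g (h : D.IsRegular p q) (j : Fin m)
    (ζ : ℂ) (k : ℕ) (u : ℂ) :
    principalPart (fun t => ζ / (coeffX 1 (D.sig j) t ^ k * deriv (D.g q j) t)) (q j) u =
      ζ / (2 * (u - q j)) := by
  have hσ := (h.analyticAt_sig_one j).fun_pow k
  have hg := (h.analyticAt_g j).deriv
  have hderiv : deriv (fun t => coeffX 1 (D.sig j) t ^ k * deriv (D.g q j) t) (q j) = 2 := by
    rw [deriv_fun_mul hσ.differentiableAt hg.differentiableAt, h.deriv_g_self,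
      h.deriv_deriv_g_self, h.sig_one]
    ring
  rw [principalPart_const_div (hσ.fun_mul hg) (by simp [h.deriv_g_self])
    (hderiv ▸ two_ne_zero), hderiv]

lemma IsRegular.bOne_apply (h : D.IsRegular p q) (u : ℂ) :
    D.bOne q u = -∑ j, taylorCoeff 1 (D.z j) 0 / (2 * (u - q j)) := by
  rw [bOne]
  congr 1
  exact Finset.sum_congr rfl fun j _ => by
    simpa using h.principalPart_div_sig_pow_mul_deriv_g j (taylorCoeff 1 (D.z j) 0) 1 u

lemma meromorphicAt_bN (k : ℕ) (u : ℂ) : MeromorphicAt (D.bN p q k) u := by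
  match k with
  | 0 => exact MeromorphicAt.const _ _
  | 1 => exact meromorphicAt_bOne u
  | k + 2 => exact meromorphicAt_nextB _ _ u

lemma IsRegular.meromorphicAt_resBq (h : D.IsRegular p q) (hk : 2 ≤ k) {j : Fin m}
    (hb : MeromorphicAt (D.bQ p q k j) (q j)) :
    MeromorphicAt (D.resBq q k (D.truncB p q (k - 1)) j) (q j) := by
  have hσ (r : ℕ) := (analyticAt_coeffX (h.sig_analytic j) r).meromorphicAt
  have hbN : MeromorphicAt (D.bN p q k) (q j) := meromorphicAt_bN k _
  have hbOne : MeromorphicAt (D.bOne q) (q j) := meromorphicAt_bOne _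
  have hz := (MeromorphicAt.const (taylorCoeff k (D.z j) 0) _).fun_div
    (h.analyticAt_g j).deriv.meromorphicAt
  refine (((hb.fun_sub (((hσ 1).fun_pow k).fun_mul hbN)).fun_sub
    ((hσ k).fun_mul hbOne)).fun_sub hz).congr (.of_forall fun t => ?_)
  simp only [bQ, if_neg (show k ≠ 1 by lia)]
  ring

lemma IsRegular.meromorphicAt_polar (h : D.IsRegular p q) (hk : 2 ≤ k) {j : Fin m}
    (hb : MeromorphicAt (D.bQ p q k j) (q j)) :
    MeromorphicAt (fun t => taylorCoeff k (D.z j) 0 / (coeffX 1 (D.sig j) t ^ k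
      * deriv (D.g q j) t) + D.resBq q k (D.truncB p q (k - 1)) j t
        / coeffX 1 (D.sig j) t ^ k) (q j) := by
  have hσ := (h.analyticAt_sig_one j).meromorphicAt.fun_pow k
  exact ((MeromorphicAt.const _ _).fun_div
    (hσ.fun_mul (h.analyticAt_g j).deriv.meromorphicAt)).fun_add
      ((h.meromorphicAt_resBq hk hb).fun_div hσ)

lemma AgreeBelow.nextB_sub {r : ℕ} (h : AgreeBelow D D' p q (r + 2))
    (hb : ∀ j, MeromorphicAt (D.bQ p q (r + 2) j) (q j))
    (hb' : ∀ j, MeromorphicAt (D'.bQ p q (r + 2) j) (q j)) (u : ℂ) :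
    D.nextB p q (r + 2) (D.truncB p q (r + 1)) u
        - D'.nextB p q (r + 2) (D'.truncB p q (r + 1)) u =
      -∑ j, (taylorCoeff (r + 2) (D.z j) 0 - taylorCoeff (r + 2) (D'.z j) 0)
        / (2 * (u - q j)) := by
  have hk : 2 ≤ r + 2 := by lia
  rw [nextB, nextB, h.sum_principalPart_resBp_eq hk, h.truncB_eq le_rfl, sub_sub_sub_cancel_left,
    ← neg_sub, ← Finset.sum_sub_distrib]
  congr 1
  refine Finset.sum_congr rfl fun j _ => ?_
  rw [← h.truncB_eq le_rfl, ← h.regular.principalPart_div_sig_pow_mul_deriv_g j _ (r + 2)]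
  have hm := h.regular.meromorphicAt_polar hk (hb j)
  have hm' := h.regular'.meromorphicAt_polar hk (hb' j)
  simp only [Nat.add_succ_sub_one, ← h.truncB_eq le_rfl] at hm hm'
  rw [← principalPart_sub hm hm']
  refine congrFun (principalPart_congr ?_) u
  filter_upwards [h.resBq_eventuallyEq hk r j, h.sig_one_punctured hk j, h.deriv_g j]
    with t hres hσ hg
  rw [hres, ← hσ, ← hg]
  ring

lemma AgreeBelow.bN_sub (h : AgreeBelow D D' p q k) (hk : 1 ≤ k)
    (hb : ∀ j, MeromorphicAt (D.bQ p q k j) (q j))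
    (hb' : ∀ j, MeromorphicAt (D'.bQ p q k j) (q j)) (u : ℂ) :
    D.bN p q k u - D'.bN p q k u =
      -∑ j, (taylorCoeff k (D.z j) 0 - taylorCoeff k (D'.z j) 0) / (2 * (u - q j)) := by
  match k with
  | 1 =>
    simp only [bN, h.regular.bOne_apply, h.regular'.bOne_apply, sub_div, Finset.sum_sub_distrib]
    ring
  | k + 2 => exact h.nextB_sub hb hb' u

lemma AgreeBelow.bN_eq (h : AgreeBelow D D' p q (k + 1)) (hk : 1 ≤ k) :
    D.bN p q k = D'.bN p q k := by
  match k with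
  | 1 => exact h.bOne_eq le_rfl
  | k + 2 => rw [bN, bN, h.nextB_eq (by lia), (h.mono (Nat.le_succ _)).truncB_eq le_rfl]

lemma AgreeBelow.aP_eventuallyEq (h : AgreeBelow D D' p q k) (hk : 1 ≤ k) {i : Fin (n + 1)}
    (hε : coeffX k (D.eps i) =ᶠ[𝓝[≠] (p i)] coeffX k (D'.eps i)) :
    D.aP p q k i =ᶠ[𝓝[≠] (p i)] D'.aP p q k i := by
  match k with
  | 1 =>
    filter_upwards [hε] with u hu
    simp [aP, hu]
  | k + 2 =>
    have hk2 : 2 ≤ k + 2 := by lia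
    filter_upwards [hε, h.resAp_eventuallyEq k i, h.eps_one_punctured hk2 i] with u hu hres hε1
    simp only [aP, hu, hε1, h.aN_eq hk2, ← h.truncA_eq le_rfl, Nat.add_succ_sub_one, hres]

lemma AgreeBelow.aQ_eventuallyEq (h : AgreeBelow D D' p q k) (hk : 1 ≤ k) {j : Fin m}
    (hσ : coeffX k (D.sig j) =ᶠ[𝓝[≠] (q j)] coeffX k (D'.sig j)) :
    D.aQ p q k j =ᶠ[𝓝[≠] (q j)] D'.aQ p q k j := by
  match k with
  | 1 =>
    filter_upwards [hσ] with u hu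
    simp [aQ, hu]
  | k + 2 =>
    have hk2 : 2 ≤ k + 2 := by lia
    filter_upwards [hσ, h.resAq_eventuallyEq k j, h.sig_one_punctured hk2 j] with u hu hres hσ1
    simp only [aQ, hu, hσ1, h.aN_eq hk2, ← h.truncA_eq le_rfl, Nat.add_succ_sub_one, hres]

lemma AgreeBelow.bP_sub (h : AgreeBelow D D' p q k) (hk : 1 ≤ k) {i : Fin (n + 1)}
    (hε : coeffX k (D.eps i) =ᶠ[𝓝[≠] (p i)] coeffX k (D'.eps i)) :
    ∀ᶠ u in 𝓝[≠] (p i), D.bP p q k i u - D'.bP p q k i u =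
      (taylorCoeff k (D.s i) 0 - taylorCoeff k (D'.s i) 0)
        + coeffX 1 (D.eps i) u ^ k * (D.bN p q k u - D'.bN p q k u) := by
  match k with
  | 1 =>
    filter_upwards [hε] with u hu
    simp only [bP, bN, if_true, hu]
    ring
  | k + 2 =>
    have hk2 : 2 ≤ k + 2 := by lia
    filter_upwards [hε, h.resBp_eventuallyEq hk2 k i, h.eps_one_punctured hk2 i] with u hu hres hε1
    simp only [bP, hu, hε1, h.bOne_eq hk2, ← h.truncB_eq le_rfl, Nat.add_succ_sub_one, hres,
      if_neg (show k + 2 ≠ 1 by lia)]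
    ring

lemma AgreeBelow.bQ_sub (h : AgreeBelow D D' p q k) (hk : 1 ≤ k) {j : Fin m}
    (hσ : coeffX k (D.sig j) =ᶠ[𝓝[≠] (q j)] coeffX k (D'.sig j)) :
    ∀ᶠ u in 𝓝[≠] (q j), D.bQ p q k j u - D'.bQ p q k j u =
      (taylorCoeff k (D.z j) 0 - taylorCoeff k (D'.z j) 0) / deriv (D.g q j) u
        + coeffX 1 (D.sig j) u ^ k * (D.bN p q k u - D'.bN p q k u) := by
  match k with
  | 1 =>
    filter_upwards [hσ, h.deriv_g j] with u hu hg
    simp only [bQ, bN, if_true, hu, ← hg]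
    ring
  | k + 2 =>
    have hk2 : 2 ≤ k + 2 := by lia
    filter_upwards [hσ, h.resBq_eventuallyEq hk2 k j, h.sig_one_punctured hk2 j, h.deriv_g j]
      with u hu hres hσ1 hg
    simp only [bQ, hu, hσ1, ← hg, h.bOne_eq hk2, ← h.truncB_eq le_rfl, Nat.add_succ_sub_one, hres,
      if_neg (show k + 2 ≠ 1 by lia)]
    ring

lemma AgreeBelow.bP_eventuallyEq (h : AgreeBelow D D' p q (k + 1)) (hk : 1 ≤ k)
    (i : Fin (n + 1)) : D.bP p q k i =ᶠ[𝓝[≠] (p i)] D'.bP p q k i := by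
  filter_upwards [(h.mono k.le_succ).bP_sub hk
    ((h.eps i k hk k.lt_succ_self).filter_mono nhdsWithin_le_nhds)] with u hu
  rwa [h.s i k hk k.lt_succ_self, h.bN_eq hk, sub_self, sub_self, mul_zero, add_zero,
    sub_eq_zero] at hu

lemma AgreeBelow.bQ_eventuallyEq (h : AgreeBelow D D' p q (k + 1)) (hk : 1 ≤ k)
    (j : Fin m) : D.bQ p q k j =ᶠ[𝓝[≠] (q j)] D'.bQ p q k j := by
  filter_upwards [(h.mono k.le_succ).bQ_sub hk
    ((h.sig j k hk k.lt_succ_self).filter_mono nhdsWithin_le_nhds)] with u hu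
  rwa [h.z j k hk k.lt_succ_self, h.bN_eq hk, sub_self, sub_self, mul_zero, zero_div, add_zero,
    sub_eq_zero] at hu

end NormalizingData

section ImageOfGraph

variable {H H' : ℂ × ℂ → ℂ × ℂ} {c ω : ℂ} {k : ℕ}

lemma coeffX_zero_fst_of_fixes_divisor (hdiv : ∀ᶠ u in 𝓝 c, H (0, u) = (0, u)) :
    coeffX 0 (fun y => (H y).1) =ᶠ[𝓝 c] fun _ => 0 :=
  hdiv.mono fun u hu => by rw [coeffX_zero, hu]

lemma coeffX_zero_snd_of_fixes_divisor (hdiv : ∀ᶠ u in 𝓝 c, H (0, u) = (0, u)) :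
    coeffX 0 (fun y => (H y).2) =ᶠ[𝓝 c] id :=
  hdiv.mono fun u hu => by rw [coeffX_zero, hu, id]

lemma coeffX_fst_eventuallyEq (hH : AnalyticAt ℂ H (0, c)) (hH' : AnalyticAt ℂ H' (0, c))
    (hdiv : ∀ᶠ u in 𝓝 c, H (0, u) = (0, u)) (hdiv' : ∀ᶠ u in 𝓝 c, H' (0, u) = (0, u))
    (h : 1 ≤ k → coeffX k (fun y => (H y).1) =ᶠ[𝓝[≠] c] coeffX k fun y => (H' y).1) :
    coeffX k (fun y => (H y).1) =ᶠ[𝓝 c] coeffX k fun y => (H' y).1 := by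
  rcases k with _ | k
  · exact (coeffX_zero_fst_of_fixes_divisor hdiv).trans
      (coeffX_zero_fst_of_fixes_divisor hdiv').symm
  · exact eventuallyEq_of_punctured (analyticAt_coeffX (analyticAt_fst.comp hH) _)
      (analyticAt_coeffX (analyticAt_fst.comp hH') _) (h k.succ_pos)

lemma coeffX_snd_eventuallyEq (hH : AnalyticAt ℂ H (0, c)) (hH' : AnalyticAt ℂ H' (0, c))
    (hdiv : ∀ᶠ u in 𝓝 c, H (0, u) = (0, u)) (hdiv' : ∀ᶠ u in 𝓝 c, H' (0, u) = (0, u))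
    (h : 1 ≤ k → coeffX k (fun y => (H y).2) =ᶠ[𝓝[≠] c] coeffX k fun y => (H' y).2) :
    coeffX k (fun y => (H y).2) =ᶠ[𝓝 c] coeffX k fun y => (H' y).2 := by
  rcases k with _ | k
  · exact (coeffX_zero_snd_of_fixes_divisor hdiv).trans
      (coeffX_zero_snd_of_fixes_divisor hdiv').symm
  · exact eventuallyEq_of_punctured (analyticAt_coeffX (analyticAt_snd.comp hH) _)
      (analyticAt_coeffX (analyticAt_snd.comp hH') _) (h k.succ_pos)

lemma fderiv_apply_fst_eq_coeffX_one (hH : AnalyticAt ℂ H (0, c)) :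
    (fderiv ℂ H (0, c) (1, 0)).1 = coeffX 1 (fun y => (H y).1) c := by
  have hfst : AnalyticAt ℂ (fun y => (H y).1) (0, c) := analyticAt_fst.comp hH
  rw [coeffX_one hfst, derivX, hH.differentiableAt.hasFDerivAt.fst.fderiv]
  rfl

lemma IsGraphImage.taylorCoeff_sub {w w' π π' : ℂ → ℂ} (hπ : IsGraphImage H w π)
    (hπ' : IsGraphImage H' w' π') (hww' : HasJetDiff k w w' ω)
    (hH : AnalyticAt ℂ H (0, c)) (hH' : AnalyticAt ℂ H' (0, c))
    (hdiv : ∀ᶠ u in 𝓝 c, H (0, u) = (0, u)) (hdiv' : ∀ᶠ u in 𝓝 c, H' (0, u) = (0, u))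
    (hfst : ∀ r, 1 ≤ r → r ≤ k →
      coeffX r (fun y => (H y).1) =ᶠ[𝓝[≠] c] coeffX r fun y => (H' y).1)
    (hsnd : ∀ r, 1 ≤ r → r < k →
      coeffX r (fun y => (H y).2) =ᶠ[𝓝[≠] c] coeffX r fun y => (H' y).2)
    (hone : coeffX 1 (fun y => (H y).1) c = 1)
    (hw : AnalyticAt ℂ w 0) (hw' : AnalyticAt ℂ w' 0) (hw0 : w 0 = c) (hw'0 : w' 0 = c) :
    taylorCoeff k π 0 - taylorCoeff k π' 0 =
      ω + (coeffX k (fun y => (H y).2) c - coeffX k (fun y => (H' y).2) c) := by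
  have hgraph : HasJetDiff k (fun x => (x, w x)) (fun x => (x, w' x)) (0, ω) :=
    (HasJetDiff.refl k fun x => x).prodMk hww'
  have hlim : Tendsto (fun x => (x, w x)) (𝓝 0) (𝓝 (0, c)) :=
    hw0 ▸ tendsto_id.prodMk_nhds hw.continuousAt.tendsto
  have hlim' : Tendsto (fun x => (x, w' x)) (𝓝 0) (𝓝 (0, c)) :=
    hw'0 ▸ tendsto_id.prodMk_nhds hw'.continuousAt.tendsto
  have hfst_nhds (r : ℕ) (hr : r ≤ k) := coeffX_fst_eventuallyEq hH hH' hdiv hdiv' (hfst r · hr)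
  have hsnd_nhds (r : ℕ) (hr : r < k) := coeffX_snd_eventuallyEq hH hH' hdiv hdiv' (hsnd r · hr)
  have hX : HasJetDiff k (fun x => (H (x, w x)).1) (fun x => (H' (x, w' x)).1) 0 := by
    simpa [(coeffX_zero_fst_of_fixes_divisor hdiv).deriv_eq, (hfst_nhds k le_rfl).self_of_nhds]
      using hgraph.comp_of_coeffX_eq (F := fun y => (H y).1) (G := fun y => (H' y).1)
        (analyticAt_fst.comp hH) (analyticAt_fst.comp hH') (fun r hr => hfst_nhds r hr.le)
        hlim hlim' .refl
  have hU : HasJetDiff k (fun x => (H (x, w x)).2) (fun x => (H' (x, w' x)).2)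
      (ω + (coeffX k (fun y => (H y).2) c - coeffX k (fun y => (H' y).2) c)) := by
    simpa [(coeffX_zero_snd_of_fixes_divisor hdiv).deriv_eq]
      using hgraph.comp_of_coeffX_eq (F := fun y => (H y).2) (G := fun y => (H' y).2)
        (analyticAt_snd.comp hH) (analyticAt_snd.comp hH') hsnd_nhds hlim hlim' .refl
  have hderiv : HasStrictDerivAt (fun x => (H (x, w x)).1) 1 0 := by
    rw [← hone, ← fderiv_apply_fst_eq_coeffX_one hH]
    exact hasStrictDerivAt_fst_comp_graph hH hdiv hw hw0
  have hH'_lim := hH'.continuousAt.tendsto.comp hlim'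
  rw [hdiv'.self_of_nhds] at hH'_lim
  exact (HasJetDiff.of_graph hπ'.analytic hderiv (by rw [hw0, hdiv.self_of_nhds])
    hH'_lim.fst_nhds hX hπ.apply_eq hπ'.apply_eq hU).taylorCoeff_sub hπ.analytic hπ'.analytic

/-- The case of order one, where `H` is compared with `(x, u) ↦ ((H (x, u)).1, u)`. -/
lemma IsGraphImage.taylorCoeff_one {w π : ℂ → ℂ} (hπ : IsGraphImage H w π)
    (hH : AnalyticAt ℂ H (0, c)) (hdiv : ∀ᶠ u in 𝓝 c, H (0, u) = (0, u))
    (hone : coeffX 1 (fun y => (H y).1) c = 1) (hw : AnalyticAt ℂ w 0) (hw0 : w 0 = c) :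
    taylorCoeff 1 π 0 = deriv w 0 + coeffX 1 (fun y => (H y).2) c := by
  have hπ' : IsGraphImage (fun y => ((H y).1, y.2)) (fun _ => c) fun _ => c :=
    ⟨analyticAt_const, .of_forall fun _ => rfl⟩
  have hww' : HasJetDiff 1 w (fun _ => c) (deriv w 0) := by
    simpa [TangencyCurves.taylorCoeff_one] using hasJetDiff_of_taylorCoeff_eq (k := 1) hw
      (analyticAt_const (v := c)) fun r hr => by
        rw [Nat.lt_one_iff.1 hr, taylorCoeff_zero, taylorCoeff_zero, hw0]
  have hsub := hπ.taylorCoeff_sub hπ' hww' hH ((analyticAt_fst.comp hH).prod analyticAt_snd) hdiv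
    (hdiv.mono fun u hu => by rw [hu]) (fun _ _ _ => .rfl) (fun r hr hr1 => absurd hr hr1.not_ge)
    hone hw analyticAt_const hw0 rfl
  simpa [coeffX, TangencyCurves.taylorCoeff_one] using hsub

end ImageOfGraph

/-! ### The tangency curves of normalized data -/

namespace NormalizingData

variable {n m k : ℕ} {D D' : NormalizingData n m} {p : Fin (n + 1) → ℂ} {q : Fin m → ℂ}
  {i : Fin (n + 1)} {j : Fin m}

/-- `D` is regular and in `k`-normal form, and the transformations `H_{p_i}`, `H_{q_j}` are
holomorphic and equal to the identity on the divisor. These are the conditions on `D` that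
determine the coefficients of order `≤ k` of the images of the model tangency curves. -/
structure IsNormalized (D : NormalizingData n m) (p : Fin (n + 1) → ℂ) (q : Fin m → ℂ)
    (k : ℕ) : Prop where
  regular : D.IsRegular p q
  normalForm : D.InNormalForm p q k
  Hp_analytic : ∀ i, AnalyticAt ℂ (D.Hp i) (0, p i)
  Hp_divisor : ∀ i, ∀ᶠ u in 𝓝 (p i), D.Hp i (0, u) = (0, u)
  Hq_analytic : ∀ j, AnalyticAt ℂ (D.Hq j) (0, q j)
  Hq_divisor : ∀ j, ∀ᶠ u in 𝓝 (q j), D.Hq j (0, u) = (0, u)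

lemma InNormalForm.mono {k₀ : ℕ} (h : D.InNormalForm p q k₀) (hk : k ≤ k₀) :
    D.InNormalForm p q k where
  n_first r hr hrk := h.n_first r hr (hrk.trans hk)
  n_second r hr hrk := h.n_second r hr (hrk.trans hk)
  p_first r hr hrk := h.p_first r hr (hrk.trans hk)
  p_second r hr hrk := h.p_second r hr (hrk.trans hk)
  q_first r hr hrk := h.q_first r hr (hrk.trans hk)
  q_second r hr hrk := h.q_second r hr (hrk.trans hk)

lemma IsNormalizing.isNormalized {F G Fμ : ℂ × ℂ → ℂ × ℂ} (h : D.IsNormalizing p q F G Fμ)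
    (hreg : D.IsRegular p q) (hnf : D.InNormalForm p q k) : D.IsNormalized p q k where
  regular := hreg
  normalForm := hnf
  Hp_analytic i := (h.Hp_biholomorphism i).1
  Hp_divisor := h.Hp_divisor
  Hq_analytic j := (h.Hq_biholomorphism j).1
  Hq_divisor := h.Hq_divisor

lemma IsNormalized.meromorphicAt_bQ (hD : D.IsNormalized p q k) (hk : 1 ≤ k) (j : Fin m) :
    MeromorphicAt (D.bQ p q k j) (q j) :=
  (analyticAt_coeffX (analyticAt_snd.comp (hD.Hq_analytic j)) k).meromorphicAt.congr
    (hD.normalForm.q_second k hk le_rfl j)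

/-- The curve `u = c - λ x s'(x)`, along which the foliations of the linear field
`λ x ∂/∂x + (u - c) ∂/∂u` and `u + s(x) = cst` are tangent. -/
def modelCurve (c lam : ℂ) (s : ℂ → ℂ) (x : ℂ) : ℂ := c - lam * (x * deriv s x)

section ModelCurve

variable {c lam ζ : ℂ} {s s' : ℂ → ℂ}

lemma modelCurve_zero (c lam : ℂ) (s : ℂ → ℂ) : modelCurve c lam s 0 = c := by
  simp [modelCurve]

lemma analyticAt_modelCurve (hs : AnalyticAt ℂ s 0) : AnalyticAt ℂ (modelCurve c lam s) 0 :=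
  analyticAt_const.sub (analyticAt_const.mul (analyticAt_id.mul hs.deriv))

lemma deriv_modelCurve_zero (hs : AnalyticAt ℂ s 0) :
    deriv (modelCurve c lam s) 0 = -(lam * deriv s 0) := by
  have hderiv : HasDerivAt (modelCurve c lam s)
      (-(lam * (1 * deriv s 0 + 0 * deriv (deriv s) 0))) 0 :=
    (((hasDerivAt_id 0).fun_mul hs.deriv.differentiableAt.hasDerivAt).const_mul lam).const_sub c
  rw [hderiv.deriv, one_mul, zero_mul, add_zero]

lemma hasJetDiff_modelCurve (h : HasJetDiff k s s' ζ) (hk : 1 ≤ k) (hs : AnalyticAt ℂ s 0)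
    (hs' : AnalyticAt ℂ s' 0) :
    HasJetDiff k (modelCurve c lam s) (modelCurve c lam s') (-(k * lam * ζ)) := by
  obtain ⟨k, rfl⟩ := Nat.exists_eq_add_of_le' hk
  have hlim {f : ℂ → ℂ} (hf : AnalyticAt ℂ f 0) :
      Tendsto (fun x => x * deriv f x) (𝓝 0) (𝓝 0) := by
    simpa using (continuousAt_id.fun_mul hf.deriv.continuousAt).tendsto
  have haffine : HasStrictDerivAt (fun t => c - lam * t) (-(lam * 1)) 0 :=
    ((hasStrictDerivAt_id 0).const_mul lam).const_sub c
  have hvalue : -((k + 1 : ℕ) * lam * ζ) = (k + 1) * ζ * -(lam * 1) := by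
    push_cast
    ring
  rw [hvalue]
  exact (hasJetDiff_deriv h hs hs').id_mul.comp_deriv haffine (hlim hs) (hlim hs')

end ModelCurve

lemma IsNormalizing.exists_isTangencyBranch_p {F G Fμ : ℂ × ℂ → ℂ × ℂ}
    (h : D.IsNormalizing p q F G Fμ) (i : Fin (n + 1)) :
    ∃ π, IsTangencyBranch (blowUp (n - 1) F) (blowUp (m + 1) G) (p i) π ∧
      IsGraphImage (D.Hp i) (modelCurve (p i) (D.lam i) (D.s i)) π := by
  refine exists_isTangencyBranch (h.Hp_biholomorphism i) (h.Hp_divisor i) (h.Hp_F i) (h.Hp_G i)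
    (analyticAt_modelCurve (h.s_analytic i)) (modelCurve_zero _ _ _) (.of_forall fun y => ?_)
  simp only [mem_tangencyLocus, wedge, linField, modelGp, modelCurve]
  constructor <;> intro hy <;> linear_combination -hy

lemma IsNormalizing.exists_isTangencyBranch_q {F G Fμ : ℂ × ℂ → ℂ × ℂ}
    (h : D.IsNormalizing p q F G Fμ) (hreg : D.IsRegular p q) (j : Fin m) :
    ∃ π, IsTangencyBranch (blowUp (n - 1) F) (blowUp (m + 1) G) (q j) π ∧
      IsGraphImage (D.Hq j) (fun _ => q j) π := by
  refine exists_isTangencyBranch (h.Hq_biholomorphism j) (h.Hq_divisor j) (h.Hq_F j) (h.Hq_G j)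
    analyticAt_const rfl ?_
  have hg : ∀ᶠ u in 𝓝 (q j), u ≠ q j → deriv (D.g q j) u ≠ 0 :=
    eventually_nhdsWithin_iff.1 (hreg.eventually_deriv_g_ne_zero j)
  filter_upwards [(continuous_snd.tendsto ((0 : ℂ), q j)).eventually hg] with y hy
  simp only [mem_tangencyLocus, wedge, modelGq, zero_mul, one_mul, zero_sub, neg_eq_zero]
  exact ⟨fun h0 => not_imp_not.1 hy h0, fun hyq => hyq ▸ hreg.deriv_g_self j⟩

/-- The explicit part of the coefficient `c_{p_i,k}`, linear in the data of order `k`. -/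
def leadingTermP (D : NormalizingData n m) (p : Fin (n + 1) → ℂ) (q : Fin m → ℂ)
    (i : Fin (n + 1)) (k : ℕ) : ℂ :=
  (1 - k * D.lam i) * taylorCoeff k (D.s i) 0 - ∑ j, taylorCoeff k (D.z j) 0 / (2 * (p i - q j))

/-- The explicit part of the coefficient `c_{q_j,k}`, linear in the numbers `z_{l,k}`. -/
def leadingTermQ (D : NormalizingData n m) (q : Fin m → ℂ) (j : Fin m) (k : ℕ) : ℂ :=
  -(taylorCoeff k (D.z j) 0 / 2)
      * (k * deriv (coeffX 1 (D.sig j)) (q j) + iteratedDeriv 3 (D.g q j) (q j) / 4)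
    - ∑ l ∈ Finset.univ.erase j, taylorCoeff k (D.z l) 0 / (2 * (q j - q l))

lemma IsRegular.tendsto_at_p (h : D.IsRegular p q) (hpq : ∀ j, p i ≠ q j) (k : ℕ) (σ : ℂ)
    (ζ : Fin m → ℂ) :
    Tendsto (fun u => σ + coeffX 1 (D.eps i) u ^ k * -∑ j, ζ j / (2 * (u - q j))) (𝓝[≠] (p i))
      (𝓝 (σ - ∑ j, ζ j / (2 * (p i - q j)))) := by
  have hε := (analyticAt_coeffX (h.eps_analytic i) 1).continuousAt
  have hpole (j : Fin m) : ContinuousAt (fun u => ζ j / (2 * (u - q j))) (p i) :=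
    continuousAt_const.div (by fun_prop) (mul_ne_zero two_ne_zero (sub_ne_zero.2 (hpq j)))
  have hlim : ContinuousAt
      (fun u => σ + coeffX 1 (D.eps i) u ^ k * -∑ j, ζ j / (2 * (u - q j))) (p i) :=
    continuousAt_const.add
      ((hε.pow k).mul (tendsto_finsetSum Finset.univ fun j _ => hpole j).neg)
  have htendsto := hlim.tendsto.mono_left (nhdsWithin_le_nhds (s := {p i}ᶜ))
  rwa [h.eps_one, one_pow, one_mul, ← sub_eq_add_neg] at htendsto

lemma IsRegular.tendsto_at_q (h : D.IsRegular p q) (hq : ∀ l, l ≠ j → q j ≠ q l) (k : ℕ)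
    (ζ : Fin m → ℂ) :
    Tendsto (fun u => ζ j / deriv (D.g q j) u
        + coeffX 1 (D.sig j) u ^ k * -∑ l, ζ l / (2 * (u - q l))) (𝓝[≠] (q j))
      (𝓝 (-(ζ j / 2)
          * (k * deriv (coeffX 1 (D.sig j)) (q j) + iteratedDeriv 3 (D.g q j) (q j) / 4)
        - ∑ l ∈ Finset.univ.erase j, ζ l / (2 * (q j - q l)))) := by
  have hσ := h.analyticAt_sig_one j
  have hpole (l : Fin m) (hl : l ∈ Finset.univ.erase j) :
      ContinuousAt (fun u => ζ l / (2 * (u - q l))) (q j) :=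
    continuousAt_const.div (by fun_prop)
      (mul_ne_zero two_ne_zero (sub_ne_zero.2 (hq l (Finset.ne_of_mem_erase hl))))
  have hother : ContinuousAt (fun u => coeffX 1 (D.sig j) u ^ k *
      -∑ l ∈ Finset.univ.erase j, ζ l / (2 * (u - q l))) (q j) :=
    (hσ.continuousAt.pow k).mul (tendsto_finsetSum _ hpole).neg
  have hself := (tendsto_inv_sub_div (h.analyticAt_g j).deriv (h.deriv_g_self j)
    (h.deriv_deriv_g_self j) two_ne_zero (hσ.fun_pow k) (by simp [h.sig_one])).const_mul (ζ j)
  convert (hself.add (hother.tendsto.mono_left nhdsWithin_le_nhds)).congr fun u => ?_ using 2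
  · rw [deriv_fun_pow hσ.differentiableAt, h.sig_one, iteratedDeriv_succ, iteratedDeriv_succ,
      iteratedDeriv_one]
    ring
  · rw [← Finset.add_sum_erase _ _ (Finset.mem_univ j)]
    ring

end NormalizingData

/-! ### Coefficients of the tangency curves at the points `p_i` -/

namespace NormalizingData

variable {n m k : ℕ} {D D' : NormalizingData n m} {p : Fin (n + 1) → ℂ} {q : Fin m → ℂ}
  {i : Fin (n + 1)} {π π' : ℂ → ℂ}

lemma IsNormalized.coeffX_one_Hp (hD : D.IsNormalized p q k) (hk : 1 ≤ k) (i : Fin (n + 1)) :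
    coeffX 1 (fun y => (D.Hp i y).1) (p i) = 1 := by
  refine eq_of_tendsto_punctured
    (analyticAt_coeffX (analyticAt_fst.comp (hD.Hp_analytic i)) 1).continuousAt
    (hD.normalForm.p_first 1 le_rfl hk i) ?_
  have hε := (analyticAt_coeffX (hD.regular.eps_analytic i) 1).continuousAt.tendsto
  rw [hD.regular.eps_one] at hε
  exact hε.mono_left nhdsWithin_le_nhds

lemma AgreeBelow.coeffX_fst_Hp_eventuallyEq (h : AgreeBelow D D' p q k)
    (hD : D.IsNormalized p q k) (hD' : D'.IsNormalized p q k)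
    (hε : coeffX k (D.eps i) =ᶠ[𝓝 (p i)] coeffX k (D'.eps i)) (r : ℕ) (hr : 1 ≤ r)
    (hrk : r ≤ k) :
    coeffX r (fun y => (D.Hp i y).1) =ᶠ[𝓝[≠] (p i)] coeffX r fun y => (D'.Hp i y).1 := by
  have hεr : coeffX r (D.eps i) =ᶠ[𝓝 (p i)] coeffX r (D'.eps i) := by
    rcases hrk.eq_or_lt with rfl | hlt
    exacts [hε, h.eps i r hr hlt]
  have haP := (h.mono hrk).aP_eventuallyEq hr (hεr.filter_mono nhdsWithin_le_nhds)
  exact (EventuallyEq.trans (hD.normalForm.p_first r hr hrk i) haP).trans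
    (EventuallyEq.symm (hD'.normalForm.p_first r hr hrk i))

lemma AgreeBelow.coeffX_snd_Hp_eventuallyEq (h : AgreeBelow D D' p q k)
    (hD : D.IsNormalized p q k) (hD' : D'.IsNormalized p q k) (i : Fin (n + 1)) (r : ℕ)
    (hr : 1 ≤ r) (hrk : r < k) :
    coeffX r (fun y => (D.Hp i y).2) =ᶠ[𝓝[≠] (p i)] coeffX r fun y => (D'.Hp i y).2 :=
  (EventuallyEq.trans (hD.normalForm.p_second r hr hrk.le i)
    ((h.mono hrk).bP_eventuallyEq hr i)).trans
    (EventuallyEq.symm (hD'.normalForm.p_second r hr hrk.le i))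

lemma AgreeBelow.coeffX_snd_Hp_sub (h : AgreeBelow D D' p q k) (hk : 1 ≤ k)
    (hpq : ∀ j, p i ≠ q j) (hD : D.IsNormalized p q k) (hD' : D'.IsNormalized p q k)
    (hε : coeffX k (D.eps i) =ᶠ[𝓝 (p i)] coeffX k (D'.eps i)) :
    coeffX k (fun y => (D.Hp i y).2) (p i) - coeffX k (fun y => (D'.Hp i y).2) (p i) =
      (taylorCoeff k (D.s i) 0 - taylorCoeff k (D'.s i) 0)
        - ∑ j, (taylorCoeff k (D.z j) 0 - taylorCoeff k (D'.z j) 0) / (2 * (p i - q j)) := by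
  have hcont {E : NormalizingData n m} (hE : E.IsNormalized p q k) :
      ContinuousAt (coeffX k fun y => (E.Hp i y).2) (p i) :=
    (analyticAt_coeffX (analyticAt_snd.comp (hE.Hp_analytic i)) k).continuousAt
  refine eq_of_tendsto_punctured (f := fun u => coeffX k (fun y => (D.Hp i y).2) u
    - coeffX k (fun y => (D'.Hp i y).2) u) ((hcont hD).sub (hcont hD')) ?_
    (h.regular.tendsto_at_p hpq k _ _)
  filter_upwards [hD.normalForm.p_second k hk le_rfl i, hD'.normalForm.p_second k hk le_rfl i,
    h.bP_sub hk (hε.filter_mono nhdsWithin_le_nhds)] with u hu hu' hsub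
  rw [hu, hu', hsub, h.bN_sub hk (hD.meromorphicAt_bQ hk) (hD'.meromorphicAt_bQ hk)]

lemma AgreeBelow.taylorCoeff_sub_leadingTermP (h : AgreeBelow D D' p q k) (hk : 1 ≤ k)
    (hpq : ∀ j, p i ≠ q j) (hD : D.IsNormalized p q k) (hD' : D'.IsNormalized p q k)
    (hε : coeffX k (D.eps i) =ᶠ[𝓝 (p i)] coeffX k (D'.eps i))
    (hπ : IsGraphImage (D.Hp i) (modelCurve (p i) (D.lam i) (D.s i)) π)
    (hπ' : IsGraphImage (D'.Hp i) (modelCurve (p i) (D'.lam i) (D'.s i)) π') :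
    taylorCoeff k π 0 - D.leadingTermP p q i k = taylorCoeff k π' 0 - D'.leadingTermP p q i k := by
  have hs := h.regular.s_analytic i
  have hs' := h.regular'.s_analytic i
  have hlam : D'.lam i = D.lam i := by rw [h.lam]
  rw [hlam] at hπ'
  have hjet := hasJetDiff_modelCurve (c := p i) (lam := D.lam i) (h.hasJetDiff_s i) hk hs hs'
  have hsub := hπ.taylorCoeff_sub hπ' hjet (hD.Hp_analytic i) (hD'.Hp_analytic i)
    (hD.Hp_divisor i) (hD'.Hp_divisor i) (h.coeffX_fst_Hp_eventuallyEq hD hD' hε)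
    (h.coeffX_snd_Hp_eventuallyEq hD hD' i) (hD.coeffX_one_Hp hk i) (analyticAt_modelCurve hs)
    (analyticAt_modelCurve hs') (modelCurve_zero _ _ _) (modelCurve_zero _ _ _)
  rw [h.coeffX_snd_Hp_sub hk hpq hD hD' hε] at hsub
  simp only [sub_div, Finset.sum_sub_distrib] at hsub
  rw [leadingTermP, leadingTermP, hlam]
  linear_combination hsub

lemma IsNormalized.taylorCoeff_one_eq_leadingTermP (hD : D.IsNormalized p q 1)
    (hpq : ∀ j, p i ≠ q j)
    (hπ : IsGraphImage (D.Hp i) (modelCurve (p i) (D.lam i) (D.s i)) π) :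
    taylorCoeff 1 π 0 = D.leadingTermP p q i 1 := by
  have hs := hD.regular.s_analytic i
  have hsnd : coeffX 1 (fun y => (D.Hp i y).2) (p i) =
      taylorCoeff 1 (D.s i) 0 - ∑ j, taylorCoeff 1 (D.z j) 0 / (2 * (p i - q j)) := by
    refine eq_of_tendsto_punctured
      (analyticAt_coeffX (analyticAt_snd.comp (hD.Hp_analytic i)) 1).continuousAt
      (hD.normalForm.p_second 1 le_rfl le_rfl i)
      ((hD.regular.tendsto_at_p hpq 1 _ _).congr fun u => ?_)
    simp only [bP, if_true, hD.regular.bOne_apply, pow_one]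
  rw [hπ.taylorCoeff_one (hD.Hp_analytic i) (hD.Hp_divisor i) (hD.coeffX_one_Hp le_rfl i)
    (analyticAt_modelCurve hs) (modelCurve_zero _ _ _), hsnd, deriv_modelCurve_zero hs,
    leadingTermP, taylorCoeff_one, Nat.cast_one]
  ring

/-- The pairs of `k`-normalized data and the curve of tangencies at `p_i` they determine. -/
abbrev CurveDataP (p : Fin (n + 1) → ℂ) (q : Fin m → ℂ) (i : Fin (n + 1)) (k : ℕ) : Type :=
  {a : NormalizingData n m × (ℂ → ℂ) // a.1.IsNormalized p q k ∧
    IsGraphImage (a.1.Hp i) (modelCurve (p i) (a.1.lam i) (a.1.s i)) a.2}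

/-- The value at `p_i` of the functional transformation `π_{p_i,k}`: the difference between the
coefficient `c_{p_i,k}` and its leading term, as a function of the germ `ε_{i,k}` and the data of
lower order. It is extended by zero to the arguments that do not come from normalized data. Only
this value enters the formula, so the transformation itself is taken to be a constant function. -/
def transformP (p : Fin (n + 1) → ℂ) (q : Fin m → ℂ) (i : Fin (n + 1)) (k : ℕ) :
    Germ (𝓝 (p i)) ℂ × LowerData p q k → ℂ :=
  Function.extend
    (fun a : CurveDataP p q i k => (((coeffX k (a.1.1.eps i) : ℂ → ℂ) : Germ (𝓝 (p i)) ℂ),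
      a.1.1.lowerData p q k))
    (fun a => taylorCoeff k a.1.2 0 - a.1.1.leadingTermP p q i k) 0

lemma transformP_one (hpq : ∀ j, p i ≠ q j) : transformP p q i 1 = 0 := by
  have hzero : (fun a : CurveDataP p q i 1 =>
      taylorCoeff 1 a.1.2 0 - a.1.1.leadingTermP p q i 1) = 0 :=
    funext fun a => sub_eq_zero.2 (a.2.1.taylorCoeff_one_eq_leadingTermP hpq a.2.2)
  rw [transformP, hzero, Function.extend_zero]

lemma IsNormalized.taylorCoeff_eq_add_transformP (hD : D.IsNormalized p q k) (hk : 1 ≤ k)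
    (hpq : ∀ j, p i ≠ q j)
    (hπ : IsGraphImage (D.Hp i) (modelCurve (p i) (D.lam i) (D.s i)) π) :
    taylorCoeff k π 0 = D.leadingTermP p q i k +
      transformP p q i k ((coeffX k (D.eps i) : ℂ → ℂ), D.lowerData p q k) := by
  have hfactors : Function.FactorsThrough
      (fun a : CurveDataP p q i k => taylorCoeff k a.1.2 0 - a.1.1.leadingTermP p q i k)
      (fun a => (((coeffX k (a.1.1.eps i) : ℂ → ℂ) : Germ (𝓝 (p i)) ℂ),
        a.1.1.lowerData p q k)) := fun a b hab =>
    (AgreeBelow.of_lowerData_eq a.2.1.regular b.2.1.regular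
      (Prod.ext_iff.1 hab).2).taylorCoeff_sub_leadingTermP hk hpq a.2.1 b.2.1
      (Germ.coe_eq.1 (Prod.ext_iff.1 hab).1) a.2.2 b.2.2
  exact (add_eq_of_eq_sub' (hfactors.extend_apply 0 ⟨(D, π), hD, hπ⟩)).symm

end NormalizingData

/-! ### Coefficients of the tangency curves at the points `q_j` -/

namespace NormalizingData

variable {n m k : ℕ} {D D' : NormalizingData n m} {p : Fin (n + 1) → ℂ} {q : Fin m → ℂ}
  {j : Fin m} {π π' : ℂ → ℂ}

lemma IsNormalized.coeffX_one_Hq (hD : D.IsNormalized p q k) (hk : 1 ≤ k) (j : Fin m) :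
    coeffX 1 (fun y => (D.Hq j y).1) (q j) = 1 := by
  refine eq_of_tendsto_punctured
    (analyticAt_coeffX (analyticAt_fst.comp (hD.Hq_analytic j)) 1).continuousAt
    (hD.normalForm.q_first 1 le_rfl hk j) ?_
  have hσ := (analyticAt_coeffX (hD.regular.sig_analytic j) 1).continuousAt.tendsto
  rw [hD.regular.sig_one] at hσ
  exact hσ.mono_left nhdsWithin_le_nhds

lemma AgreeBelow.coeffX_fst_Hq_eventuallyEq (h : AgreeBelow D D' p q k)
    (hD : D.IsNormalized p q k) (hD' : D'.IsNormalized p q k)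
    (hσ : coeffX k (D.sig j) =ᶠ[𝓝 (q j)] coeffX k (D'.sig j)) (r : ℕ) (hr : 1 ≤ r)
    (hrk : r ≤ k) :
    coeffX r (fun y => (D.Hq j y).1) =ᶠ[𝓝[≠] (q j)] coeffX r fun y => (D'.Hq j y).1 := by
  have hσr : coeffX r (D.sig j) =ᶠ[𝓝 (q j)] coeffX r (D'.sig j) := by
    rcases hrk.eq_or_lt with rfl | hlt
    exacts [hσ, h.sig j r hr hlt]
  have haQ := (h.mono hrk).aQ_eventuallyEq hr (hσr.filter_mono nhdsWithin_le_nhds)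
  exact (EventuallyEq.trans (hD.normalForm.q_first r hr hrk j) haQ).trans
    (EventuallyEq.symm (hD'.normalForm.q_first r hr hrk j))

lemma AgreeBelow.coeffX_snd_Hq_eventuallyEq (h : AgreeBelow D D' p q k)
    (hD : D.IsNormalized p q k) (hD' : D'.IsNormalized p q k) (j : Fin m) (r : ℕ)
    (hr : 1 ≤ r) (hrk : r < k) :
    coeffX r (fun y => (D.Hq j y).2) =ᶠ[𝓝[≠] (q j)] coeffX r fun y => (D'.Hq j y).2 :=
  (EventuallyEq.trans (hD.normalForm.q_second r hr hrk.le j)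
    ((h.mono hrk).bQ_eventuallyEq hr j)).trans
    (EventuallyEq.symm (hD'.normalForm.q_second r hr hrk.le j))

lemma AgreeBelow.coeffX_snd_Hq_sub (h : AgreeBelow D D' p q k) (hk : 1 ≤ k)
    (hq : ∀ l, l ≠ j → q j ≠ q l) (hD : D.IsNormalized p q k) (hD' : D'.IsNormalized p q k)
    (hσ : coeffX k (D.sig j) =ᶠ[𝓝 (q j)] coeffX k (D'.sig j)) :
    coeffX k (fun y => (D.Hq j y).2) (q j) - coeffX k (fun y => (D'.Hq j y).2) (q j) =
      -((taylorCoeff k (D.z j) 0 - taylorCoeff k (D'.z j) 0) / 2)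
          * (k * deriv (coeffX 1 (D.sig j)) (q j) + iteratedDeriv 3 (D.g q j) (q j) / 4)
        - ∑ l ∈ Finset.univ.erase j,
            (taylorCoeff k (D.z l) 0 - taylorCoeff k (D'.z l) 0) / (2 * (q j - q l)) := by
  have hcont {E : NormalizingData n m} (hE : E.IsNormalized p q k) :
      ContinuousAt (coeffX k fun y => (E.Hq j y).2) (q j) :=
    (analyticAt_coeffX (analyticAt_snd.comp (hE.Hq_analytic j)) k).continuousAt
  refine eq_of_tendsto_punctured (f := fun u => coeffX k (fun y => (D.Hq j y).2) u
    - coeffX k (fun y => (D'.Hq j y).2) u) ((hcont hD).sub (hcont hD')) ?_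
    (h.regular.tendsto_at_q hq k fun l => taylorCoeff k (D.z l) 0 - taylorCoeff k (D'.z l) 0)
  filter_upwards [hD.normalForm.q_second k hk le_rfl j, hD'.normalForm.q_second k hk le_rfl j,
    h.bQ_sub hk (hσ.filter_mono nhdsWithin_le_nhds)] with u hu hu' hsub
  rw [hu, hu', hsub, h.bN_sub hk (hD.meromorphicAt_bQ hk) (hD'.meromorphicAt_bQ hk)]

lemma AgreeBelow.taylorCoeff_sub_leadingTermQ (h : AgreeBelow D D' p q k) (hk : 1 ≤ k)
    (hq : ∀ l, l ≠ j → q j ≠ q l) (hD : D.IsNormalized p q k) (hD' : D'.IsNormalized p q k)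
    (hσ : coeffX k (D.sig j) =ᶠ[𝓝 (q j)] coeffX k (D'.sig j))
    (hπ : IsGraphImage (D.Hq j) (fun _ => q j) π)
    (hπ' : IsGraphImage (D'.Hq j) (fun _ => q j) π') :
    taylorCoeff k π 0 - D.leadingTermQ q j k = taylorCoeff k π' 0 - D'.leadingTermQ q j k := by
  have hσ_one : coeffX 1 (D.sig j) =ᶠ[𝓝 (q j)] coeffX 1 (D'.sig j) := by
    rcases hk.eq_or_lt with rfl | hlt
    exacts [hσ, h.sig j 1 le_rfl hlt]
  have hsub := hπ.taylorCoeff_sub hπ' (.refl k _) (hD.Hq_analytic j) (hD'.Hq_analytic j)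
    (hD.Hq_divisor j) (hD'.Hq_divisor j) (h.coeffX_fst_Hq_eventuallyEq hD hD' hσ)
    (h.coeffX_snd_Hq_eventuallyEq hD hD' j) (hD.coeffX_one_Hq hk j) analyticAt_const
    analyticAt_const rfl rfl
  rw [h.coeffX_snd_Hq_sub hk hq hD hD' hσ] at hsub
  simp only [sub_div, Finset.sum_sub_distrib] at hsub
  rw [leadingTermQ, leadingTermQ, ← hσ_one.deriv_eq, ← (h.g j).iteratedDeriv_eq 3]
  linear_combination hsub

lemma IsNormalized.taylorCoeff_one_eq_leadingTermQ (hD : D.IsNormalized p q 1)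
    (hq : ∀ l, l ≠ j → q j ≠ q l) (hπ : IsGraphImage (D.Hq j) (fun _ => q j) π) :
    taylorCoeff 1 π 0 = D.leadingTermQ q j 1 := by
  have hsnd : coeffX 1 (fun y => (D.Hq j y).2) (q j) = D.leadingTermQ q j 1 := by
    refine eq_of_tendsto_punctured
      (analyticAt_coeffX (analyticAt_snd.comp (hD.Hq_analytic j)) 1).continuousAt
      (hD.normalForm.q_second 1 le_rfl le_rfl j)
      ((hD.regular.tendsto_at_q hq 1 fun l => taylorCoeff 1 (D.z l) 0).congr fun u => ?_)
    simp only [bQ, if_true, hD.regular.bOne_apply, pow_one]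
  rw [hπ.taylorCoeff_one (hD.Hq_analytic j) (hD.Hq_divisor j) (hD.coeffX_one_Hq le_rfl j)
    analyticAt_const rfl, hsnd, deriv_const, zero_add]

/-- The pairs of `k`-normalized data and the curve of tangencies at `q_j` they determine. -/
abbrev CurveDataQ (p : Fin (n + 1) → ℂ) (q : Fin m → ℂ) (j : Fin m) (k : ℕ) : Type :=
  {a : NormalizingData n m × (ℂ → ℂ) // a.1.IsNormalized p q k ∧
    IsGraphImage (a.1.Hq j) (fun _ => q j) a.2}

/-- The value at `q_j` of the functional transformation `π_{q_j,k}`: the difference between the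
coefficient `c_{q_j,k}` and its leading term, as a function of the germ `ς_{j,k}` and the data of
lower order. It is extended by zero to the arguments that do not come from normalized data. Only
this value enters the formula, so the transformation itself is taken to be a constant function. -/
def transformQ (p : Fin (n + 1) → ℂ) (q : Fin m → ℂ) (j : Fin m) (k : ℕ) :
    Germ (𝓝 (q j)) ℂ × LowerData p q k → ℂ :=
  Function.extend
    (fun a : CurveDataQ p q j k => (((coeffX k (a.1.1.sig j) : ℂ → ℂ) : Germ (𝓝 (q j)) ℂ),
      a.1.1.lowerData p q k))
    (fun a => taylorCoeff k a.1.2 0 - a.1.1.leadingTermQ q j k) 0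

lemma transformQ_one (hq : ∀ l, l ≠ j → q j ≠ q l) : transformQ p q j 1 = 0 := by
  have hzero : (fun a : CurveDataQ p q j 1 =>
      taylorCoeff 1 a.1.2 0 - a.1.1.leadingTermQ q j 1) = 0 :=
    funext fun a => sub_eq_zero.2 (a.2.1.taylorCoeff_one_eq_leadingTermQ hq a.2.2)
  rw [transformQ, hzero, Function.extend_zero]

lemma IsNormalized.taylorCoeff_eq_add_transformQ (hD : D.IsNormalized p q k) (hk : 1 ≤ k)
    (hq : ∀ l, l ≠ j → q j ≠ q l) (hπ : IsGraphImage (D.Hq j) (fun _ => q j) π) :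
    taylorCoeff k π 0 = D.leadingTermQ q j k +
      transformQ p q j k ((coeffX k (D.sig j) : ℂ → ℂ), D.lowerData p q k) := by
  have hfactors : Function.FactorsThrough
      (fun a : CurveDataQ p q j k => taylorCoeff k a.1.2 0 - a.1.1.leadingTermQ q j k)
      (fun a => (((coeffX k (a.1.1.sig j) : ℂ → ℂ) : Germ (𝓝 (q j)) ℂ),
        a.1.1.lowerData p q k)) := fun a b hab =>
    (AgreeBelow.of_lowerData_eq a.2.1.regular b.2.1.regular
      (Prod.ext_iff.1 hab).2).taylorCoeff_sub_leadingTermQ hk hq a.2.1 b.2.1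
      (Germ.coe_eq.1 (Prod.ext_iff.1 hab).1) a.2.2 b.2.2
  exact (add_eq_of_eq_sub' (hfactors.extend_apply 0 ⟨(D, π), hD, hπ⟩)).symm

end NormalizingData

end TangencyCurves

end

theorem mainTheorem2_general {n m : ℕ} (p : Fin (n + 1) → ℂ) (q : Fin m → ℂ)
    (hq : Function.Injective q) (hpq : ∀ i j, p i ≠ q j) :
    ∃ (Tp : (i : Fin (n + 1)) → (k : ℕ) → Germ (𝓝 (p i)) ℂ → LowerData p q k → ℂ → ℂ)
      (Tq : (j : Fin m) → (k : ℕ) → Germ (𝓝 (q j)) ℂ → LowerData p q k → ℂ → ℂ),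
      (∀ i e d, Tp i 1 e d = 0) ∧ (∀ j e d, Tq j 1 e d = 0) ∧
      ∀ (F G Fμ : ℂ × ℂ → ℂ × ℂ) (D : NormalizingData n m),
        (∀ j, AnalyticAt ℂ (D.I j) (q j)) → (∀ j, D.I j (q j) = q j) →
        (∀ j, deriv (D.I j) (q j) = -1) → D.IsNormalizing p q F G Fμ →
        ∀ k₀ : ℕ, D.InNormalForm p q k₀ →
        (∀ i, ∃ π : ℂ → ℂ, IsTangencyBranch (blowUp (n - 1) F) (blowUp (m + 1) G) (p i) π ∧
          ∀ k, 1 ≤ k → k ≤ k₀ →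
            AnalyticAt ℂ
              (Tp i k ((coeffX k (D.eps i) : ℂ → ℂ) : Germ (𝓝 (p i)) ℂ) (D.lowerData p q k))
              (p i) ∧
            taylorCoeff k π 0 =
              (1 - k * D.lam i) * taylorCoeff k (D.s i) 0
                - ∑ j, taylorCoeff k (D.z j) 0 / (2 * (p i - q j))
                + Tp i k ((coeffX k (D.eps i) : ℂ → ℂ) : Germ (𝓝 (p i)) ℂ)
                    (D.lowerData p q k) (p i)) ∧
        (∀ j, ∃ π : ℂ → ℂ, IsTangencyBranch (blowUp (n - 1) F) (blowUp (m + 1) G) (q j) π ∧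
          ∀ k, 1 ≤ k → k ≤ k₀ →
            AnalyticAt ℂ
              (Tq j k ((coeffX k (D.sig j) : ℂ → ℂ) : Germ (𝓝 (q j)) ℂ) (D.lowerData p q k))
              (q j) ∧
            taylorCoeff k π 0 =
              -(taylorCoeff k (D.z j) 0 / 2)
                  * (k * deriv (coeffX 1 (D.sig j)) (q j) + iteratedDeriv 3 (D.g q j) (q j) / 4)
                - ∑ l ∈ Finset.univ.erase j, taylorCoeff k (D.z l) 0 / (2 * (q j - q l))
                + Tq j k ((coeffX k (D.sig j) : ℂ → ℂ) : Germ (𝓝 (q j)) ℂ)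
                    (D.lowerData p q k) (q j)) := by
  have hq' (j : Fin m) : ∀ l, l ≠ j → q j ≠ q l := fun l hl => (hq.ne hl).symm
  refine ⟨fun i k e d _ => NormalizingData.transformP p q i k (e, d),
    fun j k e d _ => NormalizingData.transformQ p q j k (e, d),
    fun i e d => funext fun _ => congrFun (NormalizingData.transformP_one (hpq i)) (e, d),
    fun j e d => funext fun _ => congrFun (NormalizingData.transformQ_one (hq' j)) (e, d),
    fun F G Fμ D hI hI_fix hI_deriv hN k₀ hNF => ?_⟩
  have hreg := hN.isRegular hI hI_fix hI_deriv
  have hnormalized (k : ℕ) (hk : k ≤ k₀) : D.IsNormalized p q k :=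
    hN.isNormalized hreg (hNF.mono hk)
  refine ⟨fun i => ?_, fun j => ?_⟩
  · obtain ⟨π, hbranch, himage⟩ := hN.exists_isTangencyBranch_p i
    exact ⟨π, hbranch, fun k hk hkk₀ => ⟨analyticAt_const,
      (hnormalized k hkk₀).taylorCoeff_eq_add_transformP hk (hpq i) himage⟩⟩
  · obtain ⟨π, hbranch, himage⟩ := hN.exists_isTangencyBranch_q hreg j
    exact ⟨π, hbranch, fun k hk hkk₀ => ⟨analyticAt_const,
      (hnormalized k hkk₀).taylorCoeff_eq_add_transformQ hk (hq' j) himage⟩⟩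

theorem mainTheorem2 {n m : ℕ} (hn : 1 ≤ n) (p : Fin (n + 1) → ℂ) (q : Fin m → ℂ)
    (hp : Function.Injective p) (hq : Function.Injective q) (hpq : ∀ i j, p i ≠ q j) :
    ∃ (Tp : (i : Fin (n + 1)) → (k : ℕ) → Germ (𝓝 (p i)) ℂ → LowerData p q k → ℂ → ℂ)
      (Tq : (j : Fin m) → (k : ℕ) → Germ (𝓝 (q j)) ℂ → LowerData p q k → ℂ → ℂ),
      (∀ i e d, Tp i 1 e d = 0) ∧ (∀ j e d, Tq j 1 e d = 0) ∧
      ∀ (u₀ : ℂ) (h : (ℝ → ℂ) → ℂ → ℂ) (F G Fμ : ℂ × ℂ → ℂ × ℂ) (D : NormalizingData n m),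
        MemN p u₀ h F → MemD q D.I G → MemN p u₀ h Fμ → HasStraightSeparatrices p Fμ →
        D.IsNormalizing p q F G Fμ → ∀ k₀ : ℕ, D.InNormalForm p q k₀ →
        (∀ i, ∃ π : ℂ → ℂ, IsTangencyBranch (blowUp (n - 1) F) (blowUp (m + 1) G) (p i) π ∧
          ∀ k, 1 ≤ k → k ≤ k₀ →
            AnalyticAt ℂ
              (Tp i k ((coeffX k (D.eps i) : ℂ → ℂ) : Germ (𝓝 (p i)) ℂ) (D.lowerData p q k))
              (p i) ∧
            taylorCoeff k π 0 =
              (1 - k * D.lam i) * taylorCoeff k (D.s i) 0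
                - ∑ j, taylorCoeff k (D.z j) 0 / (2 * (p i - q j))
                + Tp i k ((coeffX k (D.eps i) : ℂ → ℂ) : Germ (𝓝 (p i)) ℂ)
                    (D.lowerData p q k) (p i)) ∧
        (∀ j, ∃ π : ℂ → ℂ, IsTangencyBranch (blowUp (n - 1) F) (blowUp (m + 1) G) (q j) π ∧
          ∀ k, 1 ≤ k → k ≤ k₀ →
            AnalyticAt ℂ
              (Tq j k ((coeffX k (D.sig j) : ℂ → ℂ) : Germ (𝓝 (q j)) ℂ) (D.lowerData p q k))
              (q j) ∧
            taylorCoeff k π 0 =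
              -(taylorCoeff k (D.z j) 0 / 2)
                  * (k * deriv (coeffX 1 (D.sig j)) (q j) + iteratedDeriv 3 (D.g q j) (q j) / 4)
                - ∑ l ∈ Finset.univ.erase j, taylorCoeff k (D.z l) 0 / (2 * (q j - q l))
                + Tq j k ((coeffX k (D.sig j) : ℂ → ℂ) : Germ (𝓝 (q j)) ℂ)
                    (D.lowerData p q k) (q j)) := by
  obtain ⟨Tp, Tq, hTp, hTq, htransform⟩ := mainTheorem2_general p q hq hpq
  exact ⟨Tp, Tq, hTp, hTq, fun _ _ F G Fμ D _ hG _ _ =>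
    htransform F G Fμ D hG.invol_analytic hG.invol_fix hG.invol_deriv⟩
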